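/- For $d\in\{1,2,3,4,7\}$ and a prime $p$ let $$w_d(p)=\lim_{k\to\infty}\frac{\#\{a\in\mathbb Z/p^k\mathbb Z:\ a=x^2+dy^2\text{ for some }x,y\in\mathbb Z/p^k\mathbb Z\}}{p^k},\qquad \mathcal M_d(n)=\prod_{p\le n}w_d(p).$$ Let $Q_d$ be the set of primes $p$ such that every positive integer of the form $x^2+dy^2$ with $x,y\in\mathbb Z$ is divisible by $p$ to an exactly even power, and let $R_d$ be the set of primes $p\mid 2d$ with $p\notin Q_d$. Let $\beta_d$ be the Landau constant of the form $x^2+dy^2$, as given by Shanks' formula $$\beta_d=\delta_d\,g_d\left(\frac{2d\,L_d(1)}{\pi\,\varphi(2d)}\right)^{1/2},\qquad g_d=\prod_{\substack{p>2\\ \left(\frac{-d}{p}\right)=-1}}\left(1-p^{-2}\right)^{-1/2},\qquad L_d(1)=\sum_{m\ \mathrm{odd}}\left(\frac{-d}{m}\right)\frac1m,$$ where $\left(\frac{\cdot}{\cdot}\right)$ is the Jacobi symbol, the series is summed in increasing order of $m\ge1$, $\varphi$ is Euler's totient function, and $\delta_1=\delta_2=1$, $\delta_3=\frac23$, $\delta_4=\delta_7=\frac34$.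 Put $\mathcal L_d(n)=\beta_d/\sqrt{\log n}$. Then for each $d\in\{1,2,3,4,7\}$ the limits $w_d(p)$ exist for all primes $p$; for every $n\ge\max R_d$ $$\mathcal M_d(n)=\prod_{p\in R_d}w_d(p)\prod_{\substack{p\in Q_d\\ p\le n}}\left(1+p^{-1}\right)^{-1};$$ the product $g_d$ and the series $L_d(1)$ converge and $\beta_d>0$; and $$\lim_{n\to\infty}\frac{\mathcal M_d(n)}{\mathcal L_d(n)}=\frac12\sqrt{\frac{\pi}{e^{\gamma}}},$$ where $\gamma$ is Euler's constant. In particular the limit is the same for all five forms. -/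

import Mathlib

open Filter Topology

namespace LocalDensity

/-- `n` is represented over the integers by the form `x² + d y²`. -/
def Represents (d n : ℕ) : Prop :=
  ∃ x y : ℤ, (n : ℤ) = x ^ 2 + (d : ℤ) * y ^ 2

/-- The residue classes represented by the form `x² + d y²` in `ℤ / p ^ k ℤ`. -/
def representedResidues (d p k : ℕ) : Set (ZMod (p ^ k)) :=
  {a | ∃ x y : ZMod (p ^ k), a = x ^ 2 + (d : ZMod (p ^ k)) * y ^ 2}

/-- The proportion of elements of `ℤ / p ^ k ℤ` represented by `x² + d y²`. -/
noncomputable def residueDensity (d p k : ℕ) : ℝ :=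
  ((representedResidues d p k).ncard : ℝ) / (p : ℝ) ^ k

/-- The local density `w_d(p)`: the limit of the proportion of represented elements of
`ℤ / p ^ k ℤ` as `k → ∞`. -/
noncomputable def localDensity (d p : ℕ) : ℝ :=
  limUnder atTop (residueDensity d p)

/-- The product `M_d(n)` of the local densities over all primes `p ≤ n`. -/
noncomputable def productDensity (d n : ℕ) : ℝ :=
  ∏ p ∈ (Finset.Icc 1 n).filter Nat.Prime, localDensity d p

/-- `p ∈ Q_d`: `p` is a prime that divides every positive integer of the form `x² + d y²`
to an even power. -/
def IsQ (d p : ℕ) : Prop :=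
  p.Prime ∧ ∀ n : ℕ, 0 < n → Represents d n → Even (padicValNat p n)

open Classical in
/-- The elements of `Q_d` up to `n`. -/
noncomputable def primesQ (d n : ℕ) : Finset ℕ :=
  (Finset.Icc 1 n).filter (IsQ d)

open Classical in
/-- The finite set `R_d` of exceptional primes: the primes dividing `2d` that are not in `Q_d`
(that is `{2}, {2}, {3}, {2}, {2, 7}` for `d = 1, 2, 3, 4, 7`). -/
noncomputable def primesR (d : ℕ) : Finset ℕ :=
  (2 * d).primeFactors.filter (fun p => ¬ IsQ d p)

/-- The odd primes `p` with `(-d / p) = -1`. -/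
def InertPrime (d : ℕ) : Type :=
  {p : ℕ // p.Prime ∧ Odd p ∧ jacobiSym (-(d : ℤ)) p = -1}

/-- The factor `(1 - p⁻²)^(-1/2)`. -/
noncomputable def gFactor (d : ℕ) (p : InertPrime d) : ℝ :=
  (1 - ((p.1 : ℝ) ^ 2)⁻¹) ^ (-(1 / 2) : ℝ)

/-- `g_d = ∏ (1 - p⁻²)^(-1/2)` over the odd primes `p` with `(-d / p) = -1`. -/
noncomputable def gConst (d : ℕ) : ℝ :=
  ∏' p : InertPrime d, gFactor d p

/-- The sum of `(-d / m) / m` over the odd `m ≤ N`, with `(-d / m)` the Jacobi symbol. -/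
noncomputable def oddLPartialSum (d N : ℕ) : ℝ :=
  ∑ m ∈ (Finset.Icc 1 N).filter Odd, (jacobiSym (-(d : ℤ)) m : ℝ) / (m : ℝ)

/-- `L_d(1)`, the sum of the (conditionally convergent) series of `(-d / m) / m` over odd `m`,
taken in increasing order. -/
noncomputable def oddL (d : ℕ) : ℝ :=
  limUnder atTop (oddLPartialSum d)

/-- `δ_d`, which is `1, 1, 2/3, 3/4, 3/4` for `d = 1, 2, 3, 4, 7`; other `d` are not used. -/
noncomputable def deltaConst (d : ℕ) : ℝ :=
  if d = 3 then 2 / 3 else if d = 4 ∨ d = 7 then 3 / 4 else 1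

/-- Shanks' formula for Landau's constant,
`β_d = δ_d g_d (2 d L_d(1) / (π φ(2d)))^(1/2)`. -/
noncomputable def landauConst (d : ℕ) : ℝ :=
  deltaConst d * gConst d *
    Real.sqrt (oddL d * ((2 * d : ℕ) : ℝ) / (Real.pi * (Nat.totient (2 * d) : ℝ)))

/-- The Landau density `β_d / √(log n)`. -/
noncomputable def landauDensity (d n : ℕ) : ℝ :=
  landauConst d / Real.sqrt (Real.log n)

end LocalDensity

/-! Local side. At an odd prime `p` not dividing `2d` there are two cases. If `-d` is a square mod
`p`, it is a `p`-adic square, the form factors modulo `p ^ k` and takes every value, so the density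
is 1. If `-d` is not a square (`p` inert), then `p ∣ x² + d y²` forces `p ∣ x` and `p ∣ y`. All
units are values and the multiples of `p` reproduce the problem scaled by `p²`, so the density is
`(1 - 1/p) / (1 - p⁻²) = (1 + 1/p)⁻¹`. The primes dividing `2d` are treated one at a time
(`RamifiedData`), and their densities multiply to `δ_d / 2`. Hence eventually `M_d(n)` is `δ_d / 2`
times the product of `(1 + 1/q)⁻¹` over the inert `q ≤ n`.

Analytic side. With `t = 1/q`, `(1 + t)⁻¹ = (1 - t²)^(-1/2) * ((1 + t)/(1 - t))^(-1/2)`. The first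
factor yields `g_d`. For the second, `tendsto_sum_inert_log_ratio` shows that the sum of `log ((1 +
t)/(1 - t))` over inert `q ≤ x` is `log log x + γ + log (∏_{p ∣ 4d} (1 - 1/p) / L_d(1)) + o(1)`. As
`∏_{p ∣ 4d} (1 - 1/p) = φ(2d)/(2d)`, every factor of Shanks' formula cancels except `π`, leaving
`(1/2) √(π e^{-γ})`.

The constant of this Mertens theorem is found by comparing truncation at `x` with damping by
`n^(-ε)`. The damped sum is the logarithm of an Euler product: it equals `log (ζ(s) ∏_{p ∣ N} (1 -
p⁻ˢ) / L(s, χ))` at `s = 1 + ε`, with a known limit after adding `log ε`. To pass between the two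
sums, the explicit sequence `dyadic` (`1/k` at `2 ^ k`) is subtracted from `2/q`. Mertens' first
theorem and Dirichlet's test make the difference summable to a limit, and Abel's theorem says that
damping gives the same limit. For `dyadic`, truncation gives a harmonic number, hence `γ`, and
damping gives `-log (1 - 2^(-ε))`. The nonvanishing of `L(1, χ)` is what makes Mertens' first
theorem available for `χ`. -/

namespace LocalDensity

/-! ### Summation by parts: Dirichlet's test and Abel's theorem -/

section Summation

lemma sum_range_succ_eq_sum_Ioc {M : Type*} [AddCommMonoid M] (g : ℕ → M) (h : g 0 = 0) (N : ℕ) :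
    ∑ n ∈ Finset.range (N + 1), g n = ∑ n ∈ Finset.Ioc 0 N, g n := by
  rw [Finset.sum_range_succ', h, add_zero, Finset.range_eq_Ico, Finset.sum_Ico_add' g 0 N 1]
  congr 1

lemma abs_sum_Ioc_mul_le {a w : ℕ → ℝ} {B : ℝ} (hB : ∀ n, |∑ i ∈ Finset.Ioc 0 n, a i| ≤ B)
    (hw : ∀ n, 1 ≤ n → w (n + 1) ≤ w n) (hw0 : ∀ n, 1 ≤ n → 0 ≤ w n) {N M : ℕ} (h : N ≤ M) :
    |∑ i ∈ Finset.Ioc N M, a i * w i| ≤ 2 * B * w (N + 1) := by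
  set S : ℕ → ℝ := fun n => ∑ i ∈ Finset.Ioc 0 n, a i with hS
  -- The boundary term is removed so that the induction telescopes. The bound is `B * w (N + 1)`
  -- from the lower boundary plus `B` times the total variation of `w`.
  have key : |∑ i ∈ Finset.Ioc N M, a i * w i - S M * w (M + 1)|
      ≤ B * (2 * w (N + 1) - w (M + 1)) := by
    induction M, h using Nat.le_induction with
    | base =>
      have := mul_le_mul_of_nonneg_right (hB N) (hw0 (N + 1) (by omega))
      simp only [Finset.Ioc_self, Finset.sum_empty, zero_sub, abs_neg, abs_mul,
        abs_of_nonneg (hw0 (N + 1) (by omega))]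
      linarith
    | succ M h ih =>
      have e : S (M + 1) = S M + a (M + 1) := by
        simp only [hS]; rw [Finset.sum_Ioc_succ_top (by omega)]
      rw [Finset.sum_Ioc_succ_top h]
      have h1 := hw (M + 1) (by omega)
      have h2 : |S (M + 1) * (w (M + 1) - w (M + 2))| ≤ B * (w (M + 1) - w (M + 2)) := by
        rw [abs_mul, abs_of_nonneg (sub_nonneg.2 h1)]
        exact mul_le_mul_of_nonneg_right (hB _) (sub_nonneg.2 h1)
      calc _ = |(∑ i ∈ Finset.Ioc N M, a i * w i - S M * w (M + 1))
            + S (M + 1) * (w (M + 1) - w (M + 2))| := by rw [e]; congr 1; ring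
        _ ≤ _ := (abs_add_le _ _).trans (add_le_add ih h2)
        _ = _ := by ring
  have h2 : |S M * w (M + 1)| ≤ B * w (M + 1) := by
    rw [abs_mul, abs_of_nonneg (hw0 (M + 1) (by omega))]
    exact mul_le_mul_of_nonneg_right (hB _) (hw0 _ (by omega))
  calc _ = |(∑ i ∈ Finset.Ioc N M, a i * w i - S M * w (M + 1)) + S M * w (M + 1)| := by
          congr 1; ring
    _ ≤ _ := (abs_add_le _ _).trans (add_le_add key h2)
    _ = _ := by ring

/-- Dirichlet's test with a rate of convergence. -/
lemma exists_limit_sum_Ioc_mul {a w : ℕ → ℝ} {B : ℝ}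
    (hB : ∀ n, |∑ i ∈ Finset.Ioc 0 n, a i| ≤ B)
    (hw : ∀ n, 1 ≤ n → w (n + 1) ≤ w n) (hw0 : Tendsto w atTop (𝓝 0)) :
    ∃ l : ℝ, Tendsto (fun N => ∑ i ∈ Finset.Ioc 0 N, a i * w i) atTop (𝓝 l) ∧
      ∀ N, |l - ∑ i ∈ Finset.Ioc 0 N, a i * w i| ≤ 2 * B * w (N + 1) := by
  have hanti : ∀ n m, 1 ≤ n → n ≤ m → w m ≤ w n := by
    intro n m hn hm
    induction m, hm using Nat.le_induction with
    | base => rfl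
    | succ m h ih => exact (hw m (by omega)).trans ih
  have hpos : ∀ n, 1 ≤ n → 0 ≤ w n := fun n hn =>
    le_of_tendsto hw0 (eventually_atTop.2 ⟨n, fun m hm => hanti n m hn hm⟩)
  have hd : ∀ N M, N ≤ M → |∑ i ∈ Finset.Ioc 0 M, a i * w i - ∑ i ∈ Finset.Ioc 0 N, a i * w i|
      ≤ 2 * B * w (N + 1) := by
    intro N M h
    rw [← Finset.sum_Ioc_consecutive _ (Nat.zero_le N) h, add_sub_cancel_left]
    exact abs_sum_Ioc_mul_le hB hw hpos h
  have ht : Tendsto (fun N => 2 * B * w (N + 1)) atTop (𝓝 0) := by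
    simpa using (hw0.comp (tendsto_add_atTop_nat 1)).const_mul (2 * B)
  have hc : CauchySeq (fun N => ∑ i ∈ Finset.Ioc 0 N, a i * w i) := by
    refine cauchySeq_of_le_tendsto_0' _ (fun n m hnm => ?_) ht
    rw [dist_comm, Real.dist_eq]
    exact hd n m hnm
  obtain ⟨l, hl⟩ := cauchySeq_tendsto_of_complete hc
  refine ⟨l, hl, fun N => ?_⟩
  refine le_of_tendsto ((hl.sub_const _).abs) (eventually_atTop.2 ⟨N, fun M hM => hd N M hM⟩)

/-- Abel's theorem for Dirichlet series, at the boundary point of a convergent series. -/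
lemma tendsto_tsum_mul_rpow_neg {b : ℕ → ℝ} {C : ℝ} (h0 : b 0 = 0)
    (hb : Tendsto (fun N => ∑ i ∈ Finset.Ioc 0 N, b i) atTop (𝓝 C))
    (hs : ∀ ε : ℝ, 0 < ε → Summable fun n : ℕ => b n * (n : ℝ) ^ (-ε)) :
    Tendsto (fun ε : ℝ => ∑' n : ℕ, b n * (n : ℝ) ^ (-ε)) (𝓝[>] 0) (𝓝 C) := by
  set D : ℕ → ℝ := fun n => ∑ i ∈ Finset.Ioc 0 n, b i - C with hD
  have hD0 : Tendsto D atTop (𝓝 0) := by simpa using hb.sub_const C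
  obtain ⟨K, hK⟩ : ∃ K, ∀ n, |D n| ≤ K := by
    obtain ⟨K, hK⟩ := hD0.abs.bddAbove_range
    exact ⟨K, fun n => hK ⟨n, rfl⟩⟩
  have hK0 : 0 ≤ K := (abs_nonneg _).trans (hK 0)
  rw [Metric.tendsto_nhds]
  intro δ hδ
  obtain ⟨N₀, hN₀⟩ := (Metric.tendsto_atTop.1 hD0) (δ / 4) (by positivity)
  have hN₀' : ∀ n, N₀ ≤ n → |D n| ≤ δ / 4 := fun n hn => by
    have := hN₀ n hn
    rw [Real.dist_eq, sub_zero] at this; exact this.le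
  have hlim : Tendsto (fun ε : ℝ => K * (1 - ((N₀ + 1 : ℕ) : ℝ) ^ (-ε))) (𝓝[>] 0) (𝓝 0) := by
    have : ContinuousAt (fun ε : ℝ => K * (1 - ((N₀ + 1 : ℕ) : ℝ) ^ (-ε))) 0 := by
      have : ((N₀ + 1 : ℕ) : ℝ) ≠ 0 := by positivity
      fun_prop (disch := assumption)
    simpa using (this.tendsto).mono_left nhdsWithin_le_nhds
  filter_upwards [self_mem_nhdsWithin, hlim.eventually_lt_const (show (0 : ℝ) < δ / 4 by positivity)]
    with ε hε hεK
  have hε : 0 < ε := hε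
  set w : ℕ → ℝ := fun n => (n : ℝ) ^ (-ε) with hw
  have hw1 : w 1 = 1 := by simp [hw]
  have hwnn : ∀ n, 0 ≤ w n := fun n => by positivity
  have hwa : ∀ n, 1 ≤ n → w (n + 1) ≤ w n := fun n hn =>
    Real.rpow_le_rpow_of_nonpos (by positivity) (by simp) (by linarith)
  have hwle : ∀ n, 1 ≤ n → w n ≤ 1 := fun n hn => by
    rw [← hw1]; exact Real.rpow_le_rpow_of_nonpos (by simp) (by simpa using hn) (by linarith)
  -- Summation by parts against the centred partial sums `D`; the constant `C` is absorbed because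
  -- `w 1 = 1`.
  have hT : ∀ n, ∑ i ∈ Finset.Ioc 0 n, b i * w i - C =
      ∑ i ∈ Finset.range n, D (i + 1) * (w (i + 1) - w (i + 2)) + D n * w (n + 1) := by
    intro n
    induction n with
    | zero => simp [hD, hw1]
    | succ n ih =>
      have e : b (n + 1) = D (n + 1) - D n := by
        simp only [hD]; rw [Finset.sum_Ioc_succ_top (by omega)]; ring
      rw [Finset.sum_Ioc_succ_top (by omega), Finset.sum_range_succ, e]
      linear_combination ih
  -- Three contributions of at most `δ / 4`: below `N₀` the weights barely vary for small `ε`;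
  -- beyond it `D` is small and the variation of `w` is at most 1; the boundary term is small
  -- likewise.
  have hbound : ∀ m, |∑ i ∈ Finset.Ioc 0 (N₀ + m), b i * w i - C| ≤ δ * (3 / 4) := by
    intro m
    have e1 : |∑ i ∈ Finset.range N₀, D (i + 1) * (w (i + 1) - w (i + 2))|
        ≤ K * (1 - w (N₀ + 1)) := by
      calc _ ≤ ∑ i ∈ Finset.range N₀, K * (w (i + 1) - w (i + 2)) := by
            refine (Finset.abs_sum_le_sum_abs _ _).trans (Finset.sum_le_sum fun i _ => ?_)
            have := sub_nonneg.2 (hwa (i + 1) (by omega))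
            rw [abs_mul, abs_of_nonneg this]
            exact mul_le_mul_of_nonneg_right (hK _) this
        _ = _ := by
            rw [← Finset.mul_sum, Finset.sum_range_sub' (fun i => w (i + 1))]
            simp [hw1]
    have e2 : |∑ i ∈ Finset.range m, D (N₀ + i + 1) * (w (N₀ + i + 1) - w (N₀ + i + 2))|
        ≤ δ / 4 := by
      calc _ ≤ ∑ i ∈ Finset.range m, δ / 4 * (w (N₀ + i + 1) - w (N₀ + (i + 1) + 1)) := by
            refine (Finset.abs_sum_le_sum_abs _ _).trans (Finset.sum_le_sum fun i _ => ?_)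
            have := sub_nonneg.2 (hwa (N₀ + i + 1) (by omega))
            rw [abs_mul, abs_of_nonneg this]
            exact mul_le_mul_of_nonneg_right (hN₀' _ (by omega)) this
        _ = δ / 4 * (w (N₀ + 1) - w (N₀ + m + 1)) := by
            rw [← Finset.mul_sum, Finset.sum_range_sub' (fun i => w (N₀ + i + 1))]
        _ ≤ _ := by
            have := hwle (N₀ + 1) (by omega)
            have := hwnn (N₀ + m + 1)
            nlinarith
    have e3 : |D (N₀ + m) * w (N₀ + m + 1)| ≤ δ / 4 := by
      rw [abs_mul, abs_of_nonneg (hwnn _)]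
      have := hwle (N₀ + m + 1) (by omega)
      have := hN₀' (N₀ + m) (by omega)
      nlinarith [hwnn (N₀ + m + 1), abs_nonneg (D (N₀ + m))]
    rw [hT, Finset.sum_range_add]
    have := abs_add_three (∑ i ∈ Finset.range N₀, D (i + 1) * (w (i + 1) - w (i + 2)))
      (∑ i ∈ Finset.range m, D (N₀ + i + 1) * (w (N₀ + i + 1) - w (N₀ + i + 2)))
      (D (N₀ + m) * w (N₀ + m + 1))
    refine this.trans ?_
    have : K * (1 - w (N₀ + 1)) < δ / 4 := hεK
    linarith
  have hsum : Tendsto (fun n => ∑ i ∈ Finset.Ioc 0 (N₀ + n), b i * w i) atTop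
      (𝓝 (∑' n, b n * w n)) := by
    have h1 := ((hs ε hε).hasSum.tendsto_sum_nat).comp (tendsto_add_atTop_nat (N₀ + 1))
    refine h1.congr fun n => ?_
    have := sum_range_succ_eq_sum_Ioc (fun i => b i * w i) (by simp [h0]) (N₀ + n)
    rw [← this]
    simp only [Function.comp, hw]
    congr 2; ring
  have := le_of_tendsto ((hsum.sub_const C).abs) (Eventually.of_forall hbound)
  rw [Real.dist_eq]
  linarith

end Summation

/-! ### Real Dirichlet characters and their value at `s = 1` -/

section Characters

lemma char_natCast_sum_range_level {N : ℕ} [NeZero N] {χ : DirichletCharacter ℝ N} (hχ : χ ≠ 1) :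
    ∑ i ∈ Finset.range N, χ (i : ZMod N) = 0 := by
  rw [← MulChar.sum_eq_zero_of_ne_one hχ]
  refine Finset.sum_bij' (fun i _ => (i : ZMod N)) (fun a _ => a.val) ?_ ?_ ?_ ?_ ?_
  · simp
  · intro a _; simpa using ZMod.val_lt a
  · intro i hi; exact ZMod.val_cast_of_lt (by simpa using hi)
  · intro a _; simp
  · simp

lemma abs_char_natCast_le_one {N : ℕ} (χ : DirichletCharacter ℝ N) (n : ℕ) :
    |χ (n : ZMod N)| ≤ 1 := by
  simpa using DirichletCharacter.norm_le_one χ (n : ZMod N)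

/-- Full periods cancel and an incomplete one has at most `N` terms; the extra 1 pays for dropping
the term at 0. -/
lemma abs_sum_char_le {N : ℕ} [NeZero N] {χ : DirichletCharacter ℝ N} (hχ : χ ≠ 1) (n : ℕ) :
    |∑ i ∈ Finset.Ioc 0 n, χ (i : ZMod N)| ≤ N + 1 := by
  have h1 : ∀ n, |∑ i ∈ Finset.range n, χ (i : ZMod N)| ≤ N := by
    intro n
    induction n using Nat.strong_induction_on with
    | _ n ih =>
      rcases lt_or_ge n N with h | h
      · calc _ ≤ ∑ i ∈ Finset.range n, |χ (i : ZMod N)| := Finset.abs_sum_le_sum_abs _ _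
          _ ≤ ∑ i ∈ Finset.range n, (1 : ℝ) :=
            Finset.sum_le_sum fun i _ => abs_char_natCast_le_one χ i
          _ = n := by simp
          _ ≤ N := by exact_mod_cast h.le
      · obtain ⟨m, rfl⟩ := Nat.exists_eq_add_of_le h
        rw [Finset.sum_range_add, char_natCast_sum_range_level hχ, zero_add]
        simpa using ih m (by have := NeZero.pos N; omega)
  have h2 : ∑ i ∈ Finset.range (n + 1), χ (i : ZMod N)
      = χ ((0 : ℕ) : ZMod N) + ∑ i ∈ Finset.Ioc 0 n, χ (i : ZMod N) := by
    rw [Finset.sum_range_succ', add_comm, Finset.range_eq_Ico,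
      Finset.sum_Ico_add' (fun i : ℕ => χ (i : ZMod N)) 0 n 1]
    congr 1
  have h3 := h1 (n + 1)
  rw [h2] at h3
  have h4 := abs_char_natCast_le_one χ 0
  rw [abs_le] at *
  constructor <;> linarith [h3.1, h3.2, h4.1, h4.2]

/-- The `O(1/n)` rate is what later balances Chebyshev's bound in Mertens' theorem for `χ`. -/
lemma exists_char_L_one {N : ℕ} [NeZero N] {χ : DirichletCharacter ℝ N} (hχ : χ ≠ 1) :
    ∃ l : ℝ, Tendsto (fun n : ℕ => ∑ i ∈ Finset.Ioc 0 n, χ (i : ZMod N) * (i : ℝ)⁻¹) atTop (𝓝 l) ∧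
      ∀ n : ℕ, |l - ∑ i ∈ Finset.Ioc 0 n, χ (i : ZMod N) * (i : ℝ)⁻¹|
        ≤ 2 * (N + 1) * ((n + 1 : ℕ) : ℝ)⁻¹ :=
  exists_limit_sum_Ioc_mul (w := fun n => (n : ℝ)⁻¹) (abs_sum_char_le hχ)
    (fun n hn => by gcongr; simp) tendsto_inv_atTop_nhds_zero_nat

/-- The completely multiplicative function `n ↦ χ(n) n⁻ˢ`. -/
noncomputable def charPow {N : ℕ} (χ : DirichletCharacter ℝ N) {s : ℝ} (hs : s ≠ 0) : ℕ →*₀ ℝ where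
  toFun n := χ (n : ZMod N) * (n : ℝ) ^ (-s)
  map_zero' := by simp [Real.zero_rpow (neg_ne_zero.2 hs)]
  map_one' := by simp
  map_mul' m n := by
    simp only [Nat.cast_mul, map_mul]
    rw [Real.mul_rpow (by positivity) (by positivity)]; ring

lemma summable_norm_charPow {N : ℕ} (χ : DirichletCharacter ℝ N) {s : ℝ} (hs : 1 < s) :
    Summable fun n : ℕ => ‖χ (n : ZMod N) * (n : ℝ) ^ (-s)‖ := by
  refine Summable.of_nonneg_of_le (fun _ => norm_nonneg _) (fun n => ?_)
    (Real.summable_nat_rpow.2 (show -s < -1 by linarith))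
  rw [norm_mul, Real.norm_of_nonneg (r := (n : ℝ) ^ (-s)) (by positivity)]
  have := abs_char_natCast_le_one χ n
  exact mul_le_of_le_one_left (by positivity) this

lemma tendsto_euler_prod_char {N : ℕ} (χ : DirichletCharacter ℝ N) {s : ℝ} (hs : 1 < s) :
    Tendsto (fun n => ∏ p ∈ Nat.primesBelow n, (1 - χ (p : ZMod N) * (p : ℝ) ^ (-s))⁻¹) atTop
      (𝓝 (∑' n : ℕ, χ (n : ZMod N) * (n : ℝ) ^ (-s))) :=
  EulerProduct.eulerProduct_completely_multiplicative
    (f := charPow χ (show s ≠ 0 by linarith)) (summable_norm_charPow χ hs)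

lemma tsum_charPow_nonneg {N : ℕ} (χ : DirichletCharacter ℝ N) {s : ℝ} (hs : 1 < s) :
    0 ≤ ∑' n : ℕ, χ (n : ZMod N) * (n : ℝ) ^ (-s) := by
  refine ge_of_tendsto (tendsto_euler_prod_char χ hs) (Eventually.of_forall fun n => ?_)
  refine Finset.prod_nonneg fun p hp => inv_nonneg.2 (sub_nonneg.2 ?_)
  have hp := (Nat.prime_of_mem_primesBelow hp).one_le
  have h1 := (abs_le.1 (abs_char_natCast_le_one χ p)).2
  have h2 : (p : ℝ) ^ (-s) ≤ 1 :=
    Real.rpow_le_one_of_one_le_of_nonpos (by exact_mod_cast hp) (by linarith)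
  have h3 : 0 ≤ (p : ℝ) ^ (-s) := by positivity
  nlinarith

lemma tendsto_tsum_charPow {N : ℕ} [NeZero N] {χ : DirichletCharacter ℝ N} {l : ℝ}
    (hl : Tendsto (fun n : ℕ => ∑ i ∈ Finset.Ioc 0 n, χ (i : ZMod N) * (i : ℝ)⁻¹) atTop (𝓝 l)) :
    Tendsto (fun ε : ℝ => ∑' n : ℕ, χ (n : ZMod N) * (n : ℝ) ^ (-(1 + ε))) (𝓝[>] 0) (𝓝 l) := by
  have e : ∀ ε : ℝ, 0 < ε → ∀ n : ℕ, χ (n : ZMod N) * (n : ℝ) ^ (-(1 + ε))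
      = χ (n : ZMod N) * (n : ℝ)⁻¹ * (n : ℝ) ^ (-ε) := by
    intro ε hε n
    rcases Nat.eq_zero_or_pos n with rfl | hn
    · simp [Real.zero_rpow (show -ε + -1 ≠ 0 by linarith)]
    · rw [neg_add, Real.rpow_add (by exact_mod_cast hn), Real.rpow_neg_one]; ring
  have h := tendsto_tsum_mul_rpow_neg (b := fun n => χ (n : ZMod N) * (n : ℝ)⁻¹) (by simp) hl ?_
  · refine h.congr' ?_
    filter_upwards [self_mem_nhdsWithin] with ε hε
    exact tsum_congr fun n => (e ε hε n).symm
  · intro ε hε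
    refine ((summable_norm_charPow χ (show 1 < 1 + ε by linarith)).of_norm).congr fun n => ?_
    exact e ε hε n

/-- The Euler product of a real character is nonnegative for `s > 1`, so `l ≥ 0` by Abel's theorem.
The limit `s → 1⁺` identifies `l` with the analytically continued L-function at 1, which does not
vanish. -/
lemma char_L_one_pos {N : ℕ} [NeZero N] {χ : DirichletCharacter ℝ N} (hχ : χ ≠ 1) {l : ℝ}
    (hl : Tendsto (fun n : ℕ => ∑ i ∈ Finset.Ioc 0 n, χ (i : ZMod N) * (i : ℝ)⁻¹) atTop (𝓝 l)) :
    0 < l := by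
  have ht := tendsto_tsum_charPow hl
  have h0 : 0 ≤ l := by
    refine ge_of_tendsto ht ?_
    filter_upwards [self_mem_nhdsWithin] with ε hε
    exact tsum_charPow_nonneg χ (by simpa using hε)
  refine lt_of_le_of_ne h0 (Ne.symm ?_)
  set ψ : DirichletCharacter ℂ N := χ.ringHomComp Complex.ofRealHom with hψ
  have hψ1 : ψ ≠ 1 := (MulChar.ringHomComp_ne_one_iff Complex.ofRealHom.injective).2 hχ
  have hc : Tendsto (fun ε : ℝ => DirichletCharacter.LFunction ψ ((1 + ε : ℝ) : ℂ)) (𝓝[>] 0)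
      (𝓝 (DirichletCharacter.LFunction ψ 1)) := by
    have h1 : ContinuousAt
        (fun ε : ℝ => DirichletCharacter.LFunction ψ ((1 + ε : ℝ) : ℂ)) 0 :=
      ((DirichletCharacter.differentiable_LFunction hψ1).continuous.comp
        (by fun_prop : Continuous fun ε : ℝ => ((1 + ε : ℝ) : ℂ))).continuousAt
    simpa using h1.tendsto.mono_left nhdsWithin_le_nhds
  have hr : Tendsto (fun ε : ℝ => ((∑' n : ℕ, χ (n : ZMod N) * (n : ℝ) ^ (-(1 + ε)) : ℝ) : ℂ))
      (𝓝[>] 0) (𝓝 (l : ℂ)) := (Complex.continuous_ofReal.tendsto l).comp ht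
  have heq : (l : ℂ) = DirichletCharacter.LFunction ψ 1 := by
    refine tendsto_nhds_unique hr (hc.congr' ?_)
    filter_upwards [self_mem_nhdsWithin] with ε hε
    have hε : 0 < ε := hε
    rw [DirichletCharacter.LFunction_eq_LSeries ψ (by simpa using hε), LSeries, Complex.ofReal_tsum]
    refine tsum_congr fun n => ?_
    rw [LSeries.term_def]
    split_ifs with h
    · subst h; simp [Real.zero_rpow (show -ε + -1 ≠ 0 by linarith)]
    · simp only [hψ, MulChar.ringHomComp_apply, Complex.ofRealHom_eq_coe]
      rw [Complex.ofReal_mul, Complex.ofReal_cpow (by positivity), div_eq_mul_inv,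
        ← Complex.cpow_neg]
      simp
  intro hl0
  rw [hl0, Complex.ofReal_zero] at heq
  exact DirichletCharacter.LFunction_apply_one_ne_zero hψ1 heq.symm

end Characters

/-! ### Mertens' first theorem, plain and twisted by a character -/

section Mertens

open ArithmeticFunction

lemma sum_vonMangoldt_le (N : ℕ) :
    ∑ n ∈ Finset.Ioc 0 N, vonMangoldt n ≤ (Real.log 4 + 4) * N := by
  have := Chebyshev.psi_le_const_mul_self (x := N) (by positivity)
  simpa [Chebyshev.psi] using this

lemma sum_log_eq_log_factorial (N : ℕ) :
    ∑ n ∈ Finset.Ioc 0 N, Real.log n = Real.log N.factorial := by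
  induction N with
  | zero => simp
  | succ N ih =>
    rw [Finset.sum_Ioc_succ_top (by omega), ih, Nat.factorial_succ, Nat.cast_mul,
      Real.log_mul (by positivity) (by positivity)]
    ring

lemma abs_sum_log_sub_le {N : ℕ} (hN : N ≠ 0) :
    |∑ n ∈ Finset.Ioc 0 N, Real.log n - N * Real.log N| ≤ N := by
  rw [sum_log_eq_log_factorial, abs_le]
  have h1 := Stirling.le_log_factorial_stirling hN
  have h2 : Real.log N.factorial ≤ N * Real.log N := by
    rw [← Real.log_pow]
    exact Real.log_le_log (by positivity) (by exact_mod_cast Nat.factorial_le_pow N)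
  have h3 : 0 ≤ Real.log N := Real.log_natCast_nonneg N
  have h4 : 0 ≤ Real.log (2 * Real.pi) := Real.log_nonneg (by linarith [Real.pi_gt_three])
  constructor <;> linarith

lemma sum_log_eq_sum_vonMangoldt_mul (N : ℕ) :
    ∑ n ∈ Finset.Ioc 0 N, Real.log n = ∑ n ∈ Finset.Ioc 0 N, vonMangoldt n * ((N / n : ℕ) : ℝ) := by
  rw [← sum_Ioc_mul_zeta_eq_sum, vonMangoldt_mul_zeta]
  simp

/-- Mertens' first theorem for the von Mangoldt function. -/
lemma exists_abs_sum_vonMangoldt_div_sub_log_le :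
    ∃ C : ℝ, ∀ N : ℕ, |∑ n ∈ Finset.Ioc 0 N, vonMangoldt n / n - Real.log N| ≤ C := by
  refine ⟨Real.log 4 + 4 + 1, fun N => ?_⟩
  have hl4 : 0 < Real.log 4 := Real.log_pos (by norm_num)
  rcases Nat.eq_zero_or_pos N with rfl | hN
  · simp; linarith
  have hN' : (0 : ℝ) < N := by exact_mod_cast hN
  -- `log N!` is the sum of `Λ(n) ⌊N/n⌋`; dropping the floors costs at most `ψ(N)`, bounded by
  -- Chebyshev.
  have h1 : |N * ∑ n ∈ Finset.Ioc 0 N, vonMangoldt n / n - ∑ n ∈ Finset.Ioc 0 N, Real.log n|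
      ≤ (Real.log 4 + 4) * N := by
    rw [sum_log_eq_sum_vonMangoldt_mul, Finset.mul_sum, ← Finset.sum_sub_distrib]
    refine (Finset.abs_sum_le_sum_abs _ _).trans ((Finset.sum_le_sum fun n hn => ?_).trans
      (sum_vonMangoldt_le N))
    have hn : 0 < n := (Finset.mem_Ioc.1 hn).1
    have e : (N : ℝ) * (vonMangoldt n / n) - vonMangoldt n * ((N / n : ℕ) : ℝ)
        = vonMangoldt n * ((N : ℝ) / n - ((N / n : ℕ) : ℝ)) := by ring
    rw [e, abs_mul, abs_of_nonneg vonMangoldt_nonneg]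
    refine mul_le_of_le_one_right vonMangoldt_nonneg ?_
    rw [← Nat.floor_div_eq_div (K := ℝ), abs_le]
    have := Nat.floor_le (show (0 : ℝ) ≤ (N : ℝ) / n by positivity)
    have := Nat.lt_floor_add_one ((N : ℝ) / n)
    constructor <;> linarith
  have h2 := abs_sum_log_sub_le hN.ne'
  have h3 : |N * (∑ n ∈ Finset.Ioc 0 N, vonMangoldt n / n - Real.log N)|
      ≤ N * (Real.log 4 + 4 + 1) := by
    rw [abs_le] at *
    constructor <;> nlinarith [h1.1, h1.2, h2.1, h2.2]
  rw [abs_mul, abs_of_pos hN'] at h3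
  exact le_of_mul_le_mul_left h3 hN'

/-- `log = Λ * 1` as a Dirichlet convolution, and twisting by the completely multiplicative `χ(n)/n`
preserves convolutions. -/
lemma sum_char_log_eq {N : ℕ} (χ : DirichletCharacter ℝ N) (x : ℕ) :
    ∑ n ∈ Finset.Ioc 0 x, χ (n : ZMod N) * (n : ℝ)⁻¹ * Real.log n =
      ∑ n ∈ Finset.Ioc 0 x, χ (n : ZMod N) * (n : ℝ)⁻¹ * vonMangoldt n *
        ∑ m ∈ Finset.Ioc 0 (x / n), χ (m : ZMod N) * (m : ℝ)⁻¹ := by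
  let F : ArithmeticFunction ℝ := ⟨fun n => χ (n : ZMod N) * (n : ℝ)⁻¹, by simp⟩
  have h := sum_Ioc_mul_eq_sum_sum (F.pmul vonMangoldt) F x
  have e : ∀ n : ℕ, (F.pmul vonMangoldt * F) n = χ (n : ZMod N) * (n : ℝ)⁻¹ * Real.log n := by
    intro n
    rw [mul_apply, ← vonMangoldt_sum, Finset.mul_sum, ← Nat.map_div_right_divisors, Finset.sum_map]
    refine Finset.sum_congr rfl fun i hi => ?_
    obtain ⟨j, rfl⟩ := Nat.dvd_of_mem_divisors hi
    have hi0 : 0 < i := Nat.pos_of_mem_divisors hi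
    change F i * vonMangoldt i * F (i * j / i) = _
    rw [Nat.mul_div_cancel_left j hi0]
    simp only [F, coe_mk, Nat.cast_mul, map_mul, mul_inv]
    ring
  simp_rw [e] at h
  exact h

/-- Mertens' first theorem for a nontrivial real character. -/
lemma exists_abs_sum_char_vonMangoldt_div_le {N : ℕ} [NeZero N] {χ : DirichletCharacter ℝ N}
    (hχ : χ ≠ 1) :
    ∃ C : ℝ, ∀ x : ℕ, |∑ n ∈ Finset.Ioc 0 x, χ (n : ZMod N) * (n : ℝ)⁻¹ * vonMangoldt n| ≤ C := by
  obtain ⟨l, hl, hle⟩ := exists_char_L_one hχ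
  have hlpos := char_L_one_pos hχ hl
  obtain ⟨C₁, hC₁⟩ : ∃ C, ∀ x : ℕ,
      |∑ n ∈ Finset.Ioc 0 x, χ (n : ZMod N) * (n : ℝ)⁻¹ * Real.log n| ≤ C := by
    -- `log t / t` decreases only from `e` on, so it is frozen below 3. This alters only the terms
    -- `n = 1, 2`, each by at most 2, whence the 4 below.
    let w : ℕ → ℝ := fun n => Real.log (max n 3 : ℕ) / (max n 3 : ℕ)
    have hw : ∀ n, 1 ≤ n → w (n + 1) ≤ w n := by
      intro n _
      have h3 : ∀ m : ℕ, ((max m 3 : ℕ) : ℝ) ∈ Set.Ici (Real.exp 1) := fun m => by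
        have : (3 : ℝ) ≤ ((max m 3 : ℕ) : ℝ) := by exact_mod_cast le_max_right m 3
        exact (Real.exp_one_lt_d9.le.trans (by norm_num)).trans this
      exact Real.log_div_self_antitoneOn (h3 n) (h3 (n + 1))
        (by exact_mod_cast max_le_max_right 3 (Nat.le_succ n))
    have hw0 : Tendsto w atTop (𝓝 0) := by
      have h1 := (Real.tendsto_pow_log_div_mul_add_atTop 1 0 1 one_ne_zero).comp
        tendsto_natCast_atTop_atTop
      refine h1.congr' ?_
      filter_upwards [eventually_ge_atTop 3] with n hn
      have hn' : (3 : ℝ) ≤ n := by exact_mod_cast hn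
      simp [w, max_eq_left hn']
    obtain ⟨l', -, hl'⟩ := exists_limit_sum_Ioc_mul (abs_sum_char_le hχ) hw hw0
    refine ⟨|l'| + 2 * (N + 1) * w 1 + 4, fun x => ?_⟩
    have hwx : w (x + 1) ≤ w 1 := by
      induction x with
      | zero => rfl
      | succ x ih => exact (hw (x + 1) (by omega)).trans ih
    have h1 := (hl' x).trans (mul_le_mul_of_nonneg_left hwx (by positivity))
    have h2 : |∑ n ∈ Finset.Ioc 0 x, χ (n : ZMod N) * (n : ℝ)⁻¹ * Real.log n
        - ∑ n ∈ Finset.Ioc 0 x, χ (n : ZMod N) * w n| ≤ 4 := by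
      rw [← Finset.sum_sub_distrib]
      have hz : ∀ n : ℕ, 2 < n →
          χ (n : ZMod N) * (n : ℝ)⁻¹ * Real.log n - χ (n : ZMod N) * w n = 0 := by
        intro n hn
        simp only [w, max_eq_left (show 3 ≤ n by omega)]
        ring
      have hsub : ∑ n ∈ Finset.Ioc 0 x,
          (χ (n : ZMod N) * (n : ℝ)⁻¹ * Real.log n - χ (n : ZMod N) * w n)
          = ∑ n ∈ Finset.Ioc 0 (min x 2),
          (χ (n : ZMod N) * (n : ℝ)⁻¹ * Real.log n - χ (n : ZMod N) * w n) := by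
        symm
        refine Finset.sum_subset (Finset.Ioc_subset_Ioc_right (min_le_left _ _)) ?_
        intro n hn hn'
        simp only [Finset.mem_Ioc] at hn hn'
        exact hz n (by omega)
      rw [hsub]
      have hb : ∀ n ∈ Finset.Ioc 0 (min x 2),
          |χ (n : ZMod N) * (n : ℝ)⁻¹ * Real.log n - χ (n : ZMod N) * w n| ≤ 2 := by
        intro n hn
        simp only [Finset.mem_Ioc] at hn
        have hn1 : (1 : ℝ) ≤ n := by exact_mod_cast hn.1
        have a1 : |(n : ℝ)⁻¹ * Real.log n| ≤ 1 := by
          rw [abs_of_nonneg (mul_nonneg (by positivity) (Real.log_nonneg hn1)),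
            inv_mul_le_iff₀ (by positivity)]
          linarith [Real.log_le_sub_one_of_pos (show (0 : ℝ) < n by linarith)]
        have a2 : |w n| ≤ 1 := by
          have : (1 : ℝ) ≤ (max n 3 : ℕ) := by
            exact_mod_cast (by omega : 1 ≤ max n 3)
          simp only [w]
          rw [abs_of_nonneg (div_nonneg (Real.log_nonneg this) (by positivity)),
            div_le_one (by positivity)]
          linarith [Real.log_le_sub_one_of_pos (show (0 : ℝ) < (max n 3 : ℕ) by linarith)]
        have a3 := abs_char_natCast_le_one χ n
        calc _ = |χ (n : ZMod N)| * |(n : ℝ)⁻¹ * Real.log n - w n| := by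
              rw [← abs_mul]; congr 1; ring
          _ ≤ 1 * (|(n : ℝ)⁻¹ * Real.log n| + |w n|) := by
              gcongr
              exact abs_sub _ _
          _ ≤ 2 := by linarith
      calc _ ≤ ∑ n ∈ Finset.Ioc 0 (min x 2), (2 : ℝ) :=
            (Finset.abs_sum_le_sum_abs _ _).trans (Finset.sum_le_sum hb)
        _ ≤ 4 := by
            rw [Finset.sum_const, Nat.card_Ioc, nsmul_eq_mul]
            have : ((min x 2 - 0 : ℕ) : ℝ) ≤ 2 := by exact_mod_cast (by omega)
            linarith
    have h3 := le_abs_self l'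
    have h4 := neg_abs_le l'
    rw [abs_le] at *
    constructor <;> linarith [h1.1, h1.2, h2.1, h2.2]
  set K : ℝ := 2 * (N + 1) * (Real.log 4 + 4) with hK
  have hl4 : 0 < Real.log 4 := Real.log_pos (by norm_num)
  -- In `sum_char_log_eq` each inner sum is `l` up to `2 (N + 1) n / x`; weighted by `Λ(n) / n`, the
  -- total error is at most `2 (N + 1) ψ(x) / x ≤ K`. Positivity of `l` then allows division.
  refine ⟨(C₁ + K) / l, fun x => ?_⟩
  rw [le_div_iff₀ hlpos]
  set T := ∑ n ∈ Finset.Ioc 0 x, χ (n : ZMod N) * (n : ℝ)⁻¹ * vonMangoldt n with hT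
  have h1 : |T * l - ∑ n ∈ Finset.Ioc 0 x, χ (n : ZMod N) * (n : ℝ)⁻¹ * Real.log n| ≤ K := by
    rw [sum_char_log_eq, hT, Finset.sum_mul, ← Finset.sum_sub_distrib]
    rcases Nat.eq_zero_or_pos x with rfl | hx
    · simp; positivity
    have hx' : (0 : ℝ) < x := by exact_mod_cast hx
    calc _ ≤ ∑ n ∈ Finset.Ioc 0 x, 2 * (N + 1) / (x : ℝ) * vonMangoldt n := by
          refine (Finset.abs_sum_le_sum_abs _ _).trans (Finset.sum_le_sum fun n hn => ?_)
          have hn : 0 < n := (Finset.mem_Ioc.1 hn).1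
          have hn' : (0 : ℝ) < n := by exact_mod_cast hn
          rw [← mul_sub, abs_mul, abs_mul, abs_mul, abs_of_nonneg vonMangoldt_nonneg,
            abs_of_pos (inv_pos.2 hn')]
          have a1 := abs_char_natCast_le_one χ n
          have a2 := hle (x / n)
          have a3 : ((x / n + 1 : ℕ) : ℝ)⁻¹ ≤ (n : ℝ) / x := by
            rw [inv_le_comm₀ (by positivity) (by positivity), inv_div]
            rw [← Nat.floor_div_eq_div (K := ℝ)]
            push_cast
            exact (Nat.lt_floor_add_one _).le
          have a4 := a2.trans (mul_le_mul_of_nonneg_left a3 (by positivity))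
          calc _ ≤ 1 * (n : ℝ)⁻¹ * vonMangoldt n * (2 * (N + 1) * ((n : ℝ) / x)) := by
                have := @vonMangoldt_nonneg n
                gcongr
            _ = _ := by field_simp
      _ = 2 * (N + 1) / (x : ℝ) * ∑ n ∈ Finset.Ioc 0 x, vonMangoldt n := by rw [Finset.mul_sum]
      _ ≤ 2 * (N + 1) / (x : ℝ) * ((Real.log 4 + 4) * x) := by
          have := sum_vonMangoldt_le x
          gcongr
      _ = K := by rw [hK]; field_simp
  have h2 := hC₁ x
  have h3 : |T| * l = |T * l| := by rw [abs_mul, abs_of_pos hlpos]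
  rw [h3]
  rw [abs_le] at *
  constructor <;> linarith [h1.1, h1.2, h2.1, h2.2]

end Mertens

/-! ### Sums over inert primes, truncated and damped -/

section Inert

open ArithmeticFunction

open Classical in
/-- The indicator function of the primes `p` with `χ(p) = -1`. -/
noncomputable def inertInd {N : ℕ} (χ : DirichletCharacter ℝ N) (n : ℕ) : ℝ :=
  if n.Prime ∧ χ (n : ZMod N) = -1 then 1 else 0

lemma inertInd_nonneg {N : ℕ} (χ : DirichletCharacter ℝ N) (n : ℕ) : 0 ≤ inertInd χ n := by
  unfold inertInd; split_ifs <;> simp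

lemma inertInd_le_one {N : ℕ} (χ : DirichletCharacter ℝ N) (n : ℕ) : inertInd χ n ≤ 1 := by
  unfold inertInd; split_ifs <;> simp

lemma inertInd_zero {N : ℕ} (χ : DirichletCharacter ℝ N) : inertInd χ 0 = 0 := by
  simp [inertInd, Nat.not_prime_zero]

lemma inertInd_one {N : ℕ} (χ : DirichletCharacter ℝ N) : inertInd χ 1 = 0 := by
  simp [inertInd, Nat.not_prime_one]

lemma char_natCast_eq_zero_iff {N : ℕ} (χ : DirichletCharacter ℝ N) {p : ℕ} (hp : p.Prime) :
    χ (p : ZMod N) = 0 ↔ p ∣ N := by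
  rw [← not_iff_not, ← ZMod.isUnit_prime_iff_not_dvd hp]
  refine ⟨fun h => ?_, fun h => (h.map χ).ne_zero⟩
  by_contra h'
  exact h (χ.map_nonunit h')

lemma summable_vonMangoldt_nonprime :
    Summable fun n : ℕ => (if n.Prime then 0 else vonMangoldt n) / (n : ℝ) := by
  have h := vonMangoldt.summable_residueClass_non_primes_div (q := 1) 1
  refine h.congr fun n => ?_
  have : vonMangoldt.residueClass (1 : ZMod 1) n = vonMangoldt n := by
    rw [vonMangoldt.residueClass, Set.indicator_of_mem]
    exact Subsingleton.elim _ _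
  rw [this]

/-- Subtracting the two Mertens sums leaves `(1 - χ(n)) Λ(n) / n`, which is `2 log p / p` at inert
primes and 0 at primes with `χ(p) = 1`. Proper prime powers and the primes dividing `N` contribute a
convergent series, majorised by `e`. -/
lemma exists_abs_sum_inert_log_div_sub_log_le {N : ℕ} [NeZero N] {χ : DirichletCharacter ℝ N}
    (hχ : χ ≠ 1) (hq : ∀ a, χ a = 0 ∨ χ a = 1 ∨ χ a = -1) :
    ∃ C : ℝ, ∀ x : ℕ,
      |∑ n ∈ Finset.Ioc 0 x, inertInd χ n * (2 * Real.log n / n) - Real.log x| ≤ C := by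
  obtain ⟨C₁, h₁⟩ := exists_abs_sum_vonMangoldt_div_sub_log_le
  obtain ⟨C₂, h₂⟩ := exists_abs_sum_char_vonMangoldt_div_le hχ
  set e : ℕ → ℝ := fun n => 2 * ((if n.Prime then 0 else vonMangoldt n) / (n : ℝ))
    + (if n ∈ N.primeFactors then vonMangoldt n / n else 0) with he
  have hes : Summable e := by
    refine (summable_vonMangoldt_nonprime.mul_left 2).add ?_
    exact summable_of_ne_finset_zero (s := N.primeFactors) fun n hn => if_neg hn
  have he0 : ∀ n, 0 ≤ e n := fun n => by
    have := @vonMangoldt_nonneg n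
    simp only [he]
    refine add_nonneg (mul_nonneg (by norm_num) (div_nonneg ?_ (by positivity))) ?_ <;>
      split_ifs <;> positivity
  have hle : ∀ n, |inertInd χ n * (2 * Real.log n / n)
      - (vonMangoldt n / n - χ (n : ZMod N) * (n : ℝ)⁻¹ * vonMangoldt n)| ≤ e n := by
    intro n
    have hΛ := @vonMangoldt_nonneg n
    by_cases hp : n.Prime
    · rw [vonMangoldt_apply_prime hp] at *
      simp only [he, inertInd, true_and, hp, if_true]
      rw [vonMangoldt_apply_prime hp]
      rcases hq (n : ZMod N) with h | h | h
      · have hN : n ∈ N.primeFactors :=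
          Nat.mem_primeFactors.2 ⟨hp, (char_natCast_eq_zero_iff χ hp).1 h, NeZero.ne N⟩
        rw [h, if_pos hN, if_neg (by norm_num)]
        simp only [zero_mul, sub_zero, zero_sub, abs_neg, zero_div, mul_zero, zero_add]
        rw [abs_of_nonneg (by positivity)]
      · have hN : n ∉ N.primeFactors := fun hN => by
          have := (char_natCast_eq_zero_iff χ hp).2 (Nat.mem_primeFactors.1 hN).2.1
          rw [h] at this; norm_num at this
        rw [h, if_neg hN, if_neg (by norm_num)]
        apply le_of_eq
        rw [abs_eq_zero.2 (by ring)]; ring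
      · have hN : n ∉ N.primeFactors := fun hN => by
          have := (char_natCast_eq_zero_iff χ hp).2 (Nat.mem_primeFactors.1 hN).2.1
          rw [h] at this; norm_num at this
        rw [h, if_neg hN, if_pos rfl]
        apply le_of_eq
        rw [abs_eq_zero.2 (by ring)]; ring
    · have hN : n ∉ N.primeFactors := fun hN => hp (Nat.prime_of_mem_primeFactors hN)
      simp only [he, inertInd, false_and, hp, if_neg hN, if_false, zero_mul, zero_sub,
        abs_neg, add_zero]
      have h1 := abs_char_natCast_le_one χ n
      calc _ = |1 - χ (n : ZMod N)| * (vonMangoldt n / n) := by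
            rw [← abs_of_nonneg (show 0 ≤ vonMangoldt n / n by positivity), ← abs_mul]
            congr 1
            rw [abs_of_nonneg (show 0 ≤ vonMangoldt n / n by positivity)]; ring
        _ ≤ 2 * (vonMangoldt n / n) := by
            gcongr
            rw [abs_le] at *
            constructor <;> linarith [h1.1, h1.2]
  refine ⟨∑' n, e n + C₁ + C₂, fun x => ?_⟩
  have h3 : |∑ n ∈ Finset.Ioc 0 x, inertInd χ n * (2 * Real.log n / n)
      - (∑ n ∈ Finset.Ioc 0 x, vonMangoldt n / n
        - ∑ n ∈ Finset.Ioc 0 x, χ (n : ZMod N) * (n : ℝ)⁻¹ * vonMangoldt n)| ≤ ∑' n, e n := by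
    rw [← Finset.sum_sub_distrib, ← Finset.sum_sub_distrib]
    exact (Finset.abs_sum_le_sum_abs _ _).trans ((Finset.sum_le_sum fun n _ => hle n).trans
      (hes.sum_le_tsum _ fun n _ => he0 n))
  have h4 := h₁ x
  have h5 := h₂ x
  rw [abs_le] at *
  constructor <;> linarith [h3.1, h3.2, h4.1, h4.2, h5.1, h5.2]

/-- A comparison sequence supported on powers of two: `v(2^k) = 1/k`. -/
noncomputable def dyadic (n : ℕ) : ℝ :=
  if n = 2 ^ Nat.log 2 n then ((Nat.log 2 n : ℕ) : ℝ)⁻¹ else 0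

lemma dyadic_zero : dyadic 0 = 0 := by simp [dyadic]

lemma dyadic_one : dyadic 1 = 0 := by simp [dyadic]

lemma dyadic_two_pow (k : ℕ) : dyadic (2 ^ k) = (k : ℝ)⁻¹ := by
  simp [dyadic, Nat.log_pow]

lemma sum_dyadic_mul (g : ℕ → ℝ) {x : ℕ} (hx : x ≠ 0) :
    ∑ n ∈ Finset.Ioc 0 x, dyadic n * g n =
      ∑ k ∈ Finset.range (Nat.log 2 x + 1), (k : ℝ)⁻¹ * g (2 ^ k) := by
  have h1 : ∑ n ∈ (Finset.range (Nat.log 2 x + 1)).image (fun k => 2 ^ k), dyadic n * g n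
      = ∑ n ∈ Finset.Ioc 0 x, dyadic n * g n := by
    refine Finset.sum_subset ?_ ?_
    · intro n hn
      simp only [Finset.mem_image, Finset.mem_range] at hn
      obtain ⟨k, hk, rfl⟩ := hn
      simp only [Finset.mem_Ioc]
      exact ⟨by positivity, Nat.pow_le_of_le_log hx (by omega)⟩
    · intro n hn hn'
      have : dyadic n = 0 := by
        rw [dyadic, if_neg]
        intro h
        refine hn' (Finset.mem_image.2 ⟨Nat.log 2 n, ?_, h.symm⟩)
        have := Nat.log_mono_right (b := 2) (Finset.mem_Ioc.1 hn).2
        simpa using by omega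
      rw [this, zero_mul]
  rw [← h1, Finset.sum_image (fun a _ b _ h => Nat.pow_right_injective le_rfl h)]
  exact Finset.sum_congr rfl fun k _ => by rw [dyadic_two_pow]

lemma sum_dyadic {x : ℕ} (hx : x ≠ 0) :
    ∑ n ∈ Finset.Ioc 0 x, dyadic n = (harmonic (Nat.log 2 x) : ℝ) := by
  have := sum_dyadic_mul (fun _ => 1) hx
  simp only [mul_one] at this
  rw [this, Finset.sum_range_succ', harmonic]
  simp

lemma two_pow_log_bounds {x : ℕ} (hx : x ≠ 0) :
    (Nat.log 2 x : ℝ) * Real.log 2 ≤ Real.log x ∧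
      Real.log x ≤ ((Nat.log 2 x : ℝ) + 1) * Real.log 2 := by
  have hx' : (0 : ℝ) < x := by exact_mod_cast Nat.pos_of_ne_zero hx
  constructor
  · rw [← Real.log_pow]
    exact Real.log_le_log (by positivity) (by exact_mod_cast Nat.pow_log_le_self 2 hx)
  · have := Real.log_le_log hx'
      (show (x : ℝ) ≤ 2 ^ (Nat.log 2 x + 1) by
        exact_mod_cast (Nat.lt_pow_succ_log_self (by norm_num) x).le)
    rw [Real.log_pow] at this
    exact_mod_cast this

lemma abs_sum_dyadic_mul_log_sub_log_le (x : ℕ) :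
    |∑ n ∈ Finset.Ioc 0 x, dyadic n * Real.log n - Real.log x| ≤ Real.log 2 := by
  have hl := Real.log_pos (show (1 : ℝ) < 2 by norm_num)
  rcases Nat.eq_zero_or_pos x with rfl | hx
  · simpa using hl.le
  have h : ∑ n ∈ Finset.Ioc 0 x, dyadic n * Real.log n = (Nat.log 2 x : ℝ) * Real.log 2 := by
    rw [sum_dyadic_mul (fun n => Real.log n) hx.ne', Finset.sum_range_succ']
    simp only [Nat.cast_zero, inv_zero, zero_mul, add_zero]
    have : ∀ k ∈ Finset.range (Nat.log 2 x),
        ((k + 1 : ℕ) : ℝ)⁻¹ * Real.log ((2 ^ (k + 1) : ℕ) : ℝ) = Real.log 2 := by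
      intro k _
      rw [Nat.cast_pow, Real.log_pow, ← mul_assoc, inv_mul_cancel₀ (by positivity), one_mul]
      rfl
    rw [Finset.sum_congr rfl this]; simp
  obtain ⟨h1, h2⟩ := two_pow_log_bounds hx.ne'
  rw [h, abs_le]
  constructor <;> linarith

/-- The Taylor series of `-log (1 - z)` at `z = 2^(-ε)`, summed along the powers of two. -/
lemma hasSum_dyadic_mul_rpow {ε : ℝ} (hε : 0 < ε) :
    HasSum (fun n : ℕ => dyadic n * (n : ℝ) ^ (-ε)) (-Real.log (1 - 2 ^ (-ε))) := by
  have hinj : Function.Injective fun k : ℕ => 2 ^ (k + 1) := fun a b h => by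
    have := Nat.pow_right_injective le_rfl h; omega
  rw [← hinj.hasSum_iff]
  · have hx : |(2 : ℝ) ^ (-ε)| < 1 := by
      rw [abs_of_nonneg (by positivity)]
      exact Real.rpow_lt_one_of_one_lt_of_neg (by norm_num) (by linarith)
    convert Real.hasSum_pow_div_log_of_abs_lt_one hx using 1
    ext k
    simp only [Function.comp]
    rw [dyadic_two_pow, Nat.cast_pow, ← Real.rpow_natCast, ← Real.rpow_natCast, ← Real.rpow_mul
      (by positivity), ← Real.rpow_mul (by positivity), div_eq_inv_mul, mul_comm (-ε)]
    push_cast; rfl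
  · intro n hn
    have : dyadic n = 0 := by
      by_cases h : n = 2 ^ Nat.log 2 n
      · rcases hk : Nat.log 2 n with _ | k
        · rw [hk] at h; rw [h]; simpa using dyadic_one
        · exact absurd ⟨k, by rw [hk] at h; exact h.symm⟩ hn
      · rw [dyadic, if_neg h]
    rw [this, zero_mul]

/-- Euler's constant enters here: `H_k - log k → γ` for `k = ⌊log₂ x⌋`, while `log x / k → log 2`.
-/
lemma tendsto_harmonic_natLog_sub_log_log :
    Tendsto (fun x : ℕ => (harmonic (Nat.log 2 x) : ℝ) - Real.log (Real.log x)) atTop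
      (𝓝 (Real.eulerMascheroniConstant - Real.log (Real.log 2))) := by
  have hl := Real.log_pos (show (1 : ℝ) < 2 by norm_num)
  have hlog : Tendsto (fun x : ℕ => Nat.log 2 x) atTop atTop := by
    refine tendsto_atTop.2 fun k => ?_
    filter_upwards [eventually_ge_atTop (2 ^ k)] with x hx
    exact Nat.le_log_of_pow_le (by norm_num) hx
  have h1 := Real.tendsto_harmonic_sub_log.comp hlog
  have h2 : Tendsto (fun x : ℕ => Real.log x / (Nat.log 2 x : ℝ)) atTop (𝓝 (Real.log 2)) := by
    have hup : Tendsto (fun x : ℕ => Real.log 2 + Real.log 2 * ((Nat.log 2 x : ℕ) : ℝ)⁻¹) atTop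
        (𝓝 (Real.log 2)) := by
      simpa using ((tendsto_inv_atTop_nhds_zero_nat (𝕜 := ℝ)).comp hlog).const_mul (Real.log 2)
        |>.const_add (Real.log 2)
    refine tendsto_of_tendsto_of_tendsto_of_le_of_le' tendsto_const_nhds hup ?_ ?_
    · filter_upwards [eventually_ge_atTop 2] with x hx
      have hk : (0 : ℝ) < Nat.log 2 x := by exact_mod_cast Nat.log_pos (by norm_num) hx
      rw [le_div_iff₀ hk]
      linarith [(two_pow_log_bounds (show x ≠ 0 by omega)).1]
    · filter_upwards [eventually_ge_atTop 2] with x hx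
      have hk : (0 : ℝ) < Nat.log 2 x := by exact_mod_cast Nat.log_pos (by norm_num) hx
      rw [div_le_iff₀ hk, add_mul, mul_assoc, inv_mul_cancel₀ hk.ne']
      linarith [(two_pow_log_bounds (show x ≠ 0 by omega)).2]
  have h3 := h1.sub (h2.log hl.ne')
  refine h3.congr' ?_
  filter_upwards [eventually_ge_atTop 2] with x hx
  have hk : (0 : ℝ) < Nat.log 2 x := by exact_mod_cast Nat.log_pos (by norm_num) hx
  have hx1 : 0 < Real.log x := Real.log_pos (by exact_mod_cast hx)
  simp only [Function.comp]
  rw [Real.log_div hx1.ne' hk.ne']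
  ring

/-- The derivative of `1 - 2^(-ε)` at 0 is `log 2`. -/
lemma tendsto_log_one_sub_two_rpow :
    Tendsto (fun ε : ℝ => Real.log (1 - 2 ^ (-ε)) - Real.log ε) (𝓝[>] 0)
      (𝓝 (Real.log (Real.log 2))) := by
  have hl := Real.log_pos (show (1 : ℝ) < 2 by norm_num)
  have hd : HasDerivAt (fun ε : ℝ => 1 - (2 : ℝ) ^ (-ε)) (Real.log 2) 0 := by
    have := ((hasDerivAt_id (0 : ℝ)).neg.const_rpow (a := 2) (by norm_num)).const_sub 1
    simpa using this
  have h1 := (hasDerivAt_iff_tendsto_slope.1 hd).mono_left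
    (nhdsWithin_mono 0 (fun x (hx : 0 < x) => hx.ne' : Set.Ioi (0 : ℝ) ⊆ {0}ᶜ))
  refine (h1.log hl.ne').congr' ?_
  filter_upwards [self_mem_nhdsWithin] with ε hε
  have hε : 0 < ε := hε
  have : (0 : ℝ) < 1 - 2 ^ (-ε) :=
    sub_pos.2 (Real.rpow_lt_one_of_one_lt_of_neg (by norm_num) (by linarith))
  rw [slope_def_field]
  simp only [neg_zero, Real.rpow_zero, sub_self, sub_zero]
  rw [Real.log_div this.ne' hε.ne']

lemma summable_inert_mul_rpow {N : ℕ} (χ : DirichletCharacter ℝ N) {ε : ℝ} (hε : 0 < ε) :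
    Summable fun n : ℕ => inertInd χ n * (2 / (n : ℝ)) * (n : ℝ) ^ (-ε) := by
  refine Summable.of_nonneg_of_le (fun n => ?_) (fun n => ?_)
    ((Real.summable_nat_rpow.2 (show -(1 + ε) < -1 by linarith)).mul_left 2)
  · have := inertInd_nonneg χ n
    positivity
  · rcases Nat.eq_zero_or_pos n with rfl | hn
    · simp [inertInd_zero]; positivity
    have h1 := inertInd_le_one χ n
    rw [neg_add, Real.rpow_add (by exact_mod_cast hn), Real.rpow_neg_one, mul_assoc]
    calc _ ≤ 1 * (2 / (n : ℝ) * (n : ℝ) ^ (-ε)) := by gcongr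
      _ = _ := by ring

/-- The sum of `2 / q` over the inert primes `q ≤ x` and the sum of `2 / q ^ (1 + ε)` over all
inert primes, with their common constant. -/
lemma exists_inert_mertens {N : ℕ} [NeZero N] {χ : DirichletCharacter ℝ N}
    (hχ : χ ≠ 1) (hq : ∀ a, χ a = 0 ∨ χ a = 1 ∨ χ a = -1) :
    ∃ C : ℝ, Tendsto (fun x : ℕ => ∑ n ∈ Finset.Ioc 0 x, inertInd χ n * (2 / (n : ℝ))
        - Real.log (Real.log x)) atTop (𝓝 (C + Real.eulerMascheroniConstant)) ∧
      Tendsto (fun ε : ℝ => ∑' n : ℕ, inertInd χ n * (2 / (n : ℝ)) * (n : ℝ) ^ (-ε)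
        + Real.log ε) (𝓝[>] 0) (𝓝 C) := by
  obtain ⟨C₁, h₁⟩ := exists_abs_sum_inert_log_div_sub_log_le hχ hq
  -- With weight `log n`, both sequences have partial sums `log x + O(1)`, so `a` has bounded
  -- partial sums.
  set a : ℕ → ℝ := fun n => inertInd χ n * (2 * Real.log n / n) - dyadic n * Real.log n with ha
  have haB : ∀ x, |∑ n ∈ Finset.Ioc 0 x, a n| ≤ C₁ + Real.log 2 := by
    intro x
    have h1 := h₁ x
    have h2 := abs_sum_dyadic_mul_log_sub_log_le x
    simp only [ha]
    rw [Finset.sum_sub_distrib]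
    rw [abs_le] at *
    constructor <;> linarith [h1.1, h1.2, h2.1, h2.2]
  -- The weight `1 / log n` undoes the logarithm; it is capped at 2 because `log 1 = 0`, harmlessly
  -- since both sequences vanish at 1.
  set w : ℕ → ℝ := fun n => (Real.log (max n 2 : ℕ))⁻¹ with hwdef
  have hlpos : ∀ n : ℕ, 0 < Real.log (max n 2 : ℕ) := fun n =>
    Real.log_pos (by exact_mod_cast (by omega : 1 < max n 2))
  have hw : ∀ n, 1 ≤ n → w (n + 1) ≤ w n := by
    intro n _
    refine inv_anti₀ (hlpos n) (Real.log_le_log ?_ ?_)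
    · exact_mod_cast (by omega : 0 < max n 2)
    · exact_mod_cast (by omega : max n 2 ≤ max (n + 1) 2)
  have hw0 : Tendsto w atTop (𝓝 0) := by
    refine tendsto_inv_atTop_zero.comp (Real.tendsto_log_atTop.comp
      (tendsto_natCast_atTop_atTop.comp ?_))
    exact tendsto_atTop_mono (fun n => le_max_left n 2) tendsto_id
  obtain ⟨C', hC', -⟩ := exists_limit_sum_Ioc_mul haB hw hw0
  set b : ℕ → ℝ := fun n => inertInd χ n * (2 / (n : ℝ)) - dyadic n with hb
  have hab : ∀ n, 0 < n → a n * w n = b n := by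
    intro n hn
    rcases Nat.lt_or_ge n 2 with h | h
    · obtain rfl : n = 1 := by omega
      simp [ha, hb, inertInd_one, dyadic_one]
    · have := hlpos n
      simp only [ha, hb, hwdef]
      rw [max_eq_left h] at *
      field_simp
  have hbC : Tendsto (fun x => ∑ n ∈ Finset.Ioc 0 x, b n) atTop (𝓝 C') := by
    refine hC'.congr fun x => Finset.sum_congr rfl fun n hn => ?_
    exact hab n (Finset.mem_Ioc.1 hn).1
  have hbs : ∀ ε : ℝ, 0 < ε → HasSum (fun n : ℕ => b n * (n : ℝ) ^ (-ε))
      (∑' n : ℕ, inertInd χ n * (2 / (n : ℝ)) * (n : ℝ) ^ (-ε) - -Real.log (1 - 2 ^ (-ε))) := by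
    intro ε hε
    have h := (summable_inert_mul_rpow χ hε).hasSum.sub (hasSum_dyadic_mul_rpow hε)
    simp_rw [← sub_mul] at h
    exact h
  -- By Abel's theorem the damped and truncated differences share the limit `C'`. The `log log 2`
  -- from `dyadic` is the same in both, so only `γ` separates the two constants.
  have hA := tendsto_tsum_mul_rpow_neg (b := b) (by simp [hb, inertInd_zero, dyadic_zero]) hbC
    (fun ε hε => (hbs ε hε).summable)
  refine ⟨C' - Real.log (Real.log 2), ?_, ?_⟩
  · have h := hbC.add tendsto_harmonic_natLog_sub_log_log
    rw [show C' - Real.log (Real.log 2) + Real.eulerMascheroniConstant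
      = C' + (Real.eulerMascheroniConstant - Real.log (Real.log 2)) by ring]
    refine h.congr' ?_
    filter_upwards [eventually_ge_atTop 1] with x hx
    simp only [hb]
    rw [Finset.sum_sub_distrib, sum_dyadic (by omega)]
    ring
  · refine (hA.sub tendsto_log_one_sub_two_rpow).congr' ?_
    filter_upwards [self_mem_nhdsWithin] with ε hε
    rw [(hbs ε hε).tsum_eq]
    ring

end Inert

/-! ### Mertens' product over inert primes and its constant -/

section Inert

lemma abs_log_ratio_sub_le {t : ℝ} (h0 : 0 ≤ t) (h1 : t ≤ 1 / 2) :
    |Real.log ((1 + t) / (1 - t)) - 2 * t| ≤ 4 * t ^ 2 := by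
  have a1 := Real.abs_log_sub_add_sum_range_le (x := t) (by rw [abs_of_nonneg h0]; linarith) 1
  have a2 := Real.abs_log_sub_add_sum_range_le (x := -t)
    (by rw [abs_neg, abs_of_nonneg h0]; linarith) 1
  simp only [Finset.sum_range_one, abs_neg, abs_of_nonneg h0] at a1 a2
  norm_num at a1 a2
  have hb : t ^ 2 / (1 - t) ≤ 2 * t ^ 2 := by
    rw [div_le_iff₀ (by linarith)]; nlinarith [sq_nonneg t]
  rw [Real.log_div (by linarith) (by linarith)]
  rw [abs_le] at *
  constructor <;> linarith [a1.1, a1.2, a2.1, a2.2]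

lemma natCast_rpow_neg_le_half {n : ℕ} (hn : 2 ≤ n) {s : ℝ} (hs : 1 ≤ s) :
    (n : ℝ) ^ (-s) ≤ 1 / 2 := by
  have hn' : (2 : ℝ) ≤ n := by exact_mod_cast hn
  calc (n : ℝ) ^ (-s) ≤ (n : ℝ) ^ (-1 : ℝ) :=
        Real.rpow_le_rpow_of_exponent_le (by linarith) (by linarith)
    _ = (n : ℝ)⁻¹ := Real.rpow_neg_one _
    _ ≤ _ := by rw [one_div]; exact inv_anti₀ (by norm_num) hn'

lemma inertInd_eq_zero_of_lt_two {N : ℕ} (χ : DirichletCharacter ℝ N) {n : ℕ} (hn : n < 2) :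
    inertInd χ n = 0 := by
  interval_cases n
  · exact inertInd_zero χ
  · exact inertInd_one χ

/-- The second order part of `log ((1 + q⁻ˢ) / (1 - q⁻ˢ))` for `q` inert. -/
noncomputable def inertRemainder {N : ℕ} (χ : DirichletCharacter ℝ N) (s : ℝ) (n : ℕ) : ℝ :=
  inertInd χ n * (Real.log ((1 + (n : ℝ) ^ (-s)) / (1 - (n : ℝ) ^ (-s))) - 2 * (n : ℝ) ^ (-s))

lemma norm_inertRemainder_le {N : ℕ} (χ : DirichletCharacter ℝ N) {s : ℝ} (hs : 1 ≤ s) (n : ℕ) :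
    ‖inertRemainder χ s n‖ ≤ 4 * (n : ℝ) ^ (-2 : ℝ) := by
  rw [inertRemainder, norm_mul, Real.norm_of_nonneg (inertInd_nonneg χ n)]
  rcases lt_or_ge n 2 with hn | hn
  · rw [inertInd_eq_zero_of_lt_two χ hn, zero_mul]; positivity
  have hn' : (1 : ℝ) ≤ n := by exact_mod_cast (by omega : 1 ≤ n)
  have h := abs_log_ratio_sub_le (t := (n : ℝ) ^ (-s)) (by positivity)
    (natCast_rpow_neg_le_half hn hs)
  have h2 : ((n : ℝ) ^ (-s)) ^ 2 ≤ (n : ℝ) ^ (-2 : ℝ) := by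
    rw [← Real.rpow_natCast, ← Real.rpow_mul (by positivity)]
    exact Real.rpow_le_rpow_of_exponent_le hn' (by push_cast; linarith)
  refine (mul_le_of_le_one_left (norm_nonneg _) (inertInd_le_one χ n)).trans ?_
  rw [Real.norm_eq_abs]
  linarith

lemma summable_inertRemainder {N : ℕ} (χ : DirichletCharacter ℝ N) {s : ℝ} (hs : 1 ≤ s) :
    Summable (inertRemainder χ s) :=
  Summable.of_norm_bounded ((Real.summable_nat_rpow.2 (by norm_num)).mul_left 4)
    (norm_inertRemainder_le χ hs)

/-- Dominated convergence: the majorant `4 n⁻²` is uniform in `s ≥ 1`. -/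
lemma tendsto_tsum_inertRemainder {N : ℕ} (χ : DirichletCharacter ℝ N) :
    Tendsto (fun ε : ℝ => ∑' n, inertRemainder χ (1 + ε) n) (𝓝[>] 0)
      (𝓝 (∑' n, inertRemainder χ 1 n)) := by
  refine tendsto_tsum_of_dominated_convergence
    ((Real.summable_nat_rpow.2 (show (-2 : ℝ) < -1 by norm_num)).mul_left 4) (fun n => ?_) ?_
  · rcases lt_or_ge n 2 with hn | hn
    · simp [inertRemainder, inertInd_eq_zero_of_lt_two χ hn]
    have hn0 : (n : ℝ) ≠ 0 := by exact_mod_cast (by omega : n ≠ 0)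
    have hhalf := natCast_rpow_neg_le_half hn (le_refl (1 : ℝ))
    have hpos : 0 ≤ (n : ℝ) ^ (-1 : ℝ) := by positivity
    have hc : ContinuousAt (fun ε : ℝ => (n : ℝ) ^ (-(1 + ε))) 0 := by
      fun_prop (disch := assumption)
    have h1 : Tendsto (fun ε : ℝ => (n : ℝ) ^ (-(1 + ε))) (𝓝[>] 0) (𝓝 ((n : ℝ) ^ (-1 : ℝ))) := by
      simpa using hc.tendsto.mono_left nhdsWithin_le_nhds
    have hne : 1 - (n : ℝ) ^ (-1 : ℝ) ≠ 0 := by linarith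
    refine ((((h1.const_add 1).div (h1.const_sub 1) hne).log ?_).sub (h1.const_mul 2)).const_mul _
    exact div_ne_zero (by linarith) hne
  · filter_upwards [self_mem_nhdsWithin] with ε hε n
    exact norm_inertRemainder_le χ (by linarith [show (0 : ℝ) < ε from hε]) n

lemma inertInd_mul_log_ratio {N : ℕ} (χ : DirichletCharacter ℝ N) (ε : ℝ) (n : ℕ) :
    inertInd χ n * Real.log ((1 + (n : ℝ) ^ (-(1 + ε))) / (1 - (n : ℝ) ^ (-(1 + ε))))
      = inertInd χ n * (2 / (n : ℝ)) * (n : ℝ) ^ (-ε) + inertRemainder χ (1 + ε) n := by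
  rcases Nat.eq_zero_or_pos n with rfl | hn
  · simp [inertRemainder, inertInd_zero]
  have : (n : ℝ) ^ (-(1 + ε)) = (n : ℝ)⁻¹ * (n : ℝ) ^ (-ε) := by
    rw [neg_add, Real.rpow_add (by exact_mod_cast hn), Real.rpow_neg_one]
  rw [inertRemainder, this]
  ring

/-- Compare Euler factors, with `t = p⁻ˢ`. Those of `ζ` and `L(s, χ)` agree when `χ(p) = 1`; they
differ by `(1 + t)/(1 - t)` when `χ(p) = -1`; when `χ(p) = 0` the factor of `ζ` is cancelled by `1 -
t`. -/
lemma exp_sum_inert_log_ratio {N : ℕ} [NeZero N] {χ : DirichletCharacter ℝ N}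
    (hq : ∀ a, χ a = 0 ∨ χ a = 1 ∨ χ a = -1) {s : ℝ} (hs : 1 < s) (x : ℕ) :
    Real.exp (∑ n ∈ Finset.range x,
        inertInd χ n * Real.log ((1 + (n : ℝ) ^ (-s)) / (1 - (n : ℝ) ^ (-s)))) *
      ∏ p ∈ Nat.primesBelow x, (1 - χ (p : ZMod N) * (p : ℝ) ^ (-s))⁻¹ =
    (∏ p ∈ Nat.primesBelow x, (1 - (p : ℝ) ^ (-s))⁻¹) *
      ∏ p ∈ Nat.primesBelow x, (if p ∣ N then 1 - (p : ℝ) ^ (-s) else 1) := by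
  have e1 : ∑ n ∈ Finset.range x,
        inertInd χ n * Real.log ((1 + (n : ℝ) ^ (-s)) / (1 - (n : ℝ) ^ (-s)))
      = ∑ n ∈ Nat.primesBelow x,
        inertInd χ n * Real.log ((1 + (n : ℝ) ^ (-s)) / (1 - (n : ℝ) ^ (-s))) := by
    rw [Nat.primesBelow, Finset.sum_filter]
    refine Finset.sum_congr rfl fun n _ => ?_
    split_ifs with h
    · rfl
    · simp [inertInd, h]
  rw [e1, Real.exp_sum, ← Finset.prod_mul_distrib, ← Finset.prod_mul_distrib]
  refine Finset.prod_congr rfl fun p hp => ?_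
  have hp := Nat.prime_of_mem_primesBelow hp
  have ht := natCast_rpow_neg_le_half hp.two_le hs.le
  have ht0 : 0 ≤ (p : ℝ) ^ (-s) := by positivity
  have hne : 1 - (p : ℝ) ^ (-s) ≠ 0 := by linarith
  have hne' : 1 + (p : ℝ) ^ (-s) ≠ 0 := by linarith
  have hdiv := char_natCast_eq_zero_iff χ hp
  rcases hq (p : ZMod N) with h | h | h
  · rw [if_pos (hdiv.1 h), inertInd, h, if_neg (by norm_num)]
    field_simp
    simp
  · rw [if_neg (fun h' => by rw [hdiv.2 h'] at h; norm_num at h), inertInd, h,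
      if_neg (by norm_num)]
    simp
  · rw [if_neg (fun h' => by rw [hdiv.2 h'] at h; norm_num at h), inertInd, h,
      if_pos ⟨hp, rfl⟩, one_mul, Real.exp_log (div_pos (by linarith) (by linarith)),
      show 1 - -1 * (p : ℝ) ^ (-s) = 1 + (p : ℝ) ^ (-s) by ring]
    field_simp

lemma eventually_prod_primesBelow_dvd {N : ℕ} [NeZero N] (f : ℕ → ℝ) :
    ∀ᶠ x : ℕ in atTop, ∏ p ∈ Nat.primesBelow x, (if p ∣ N then f p else 1)
      = ∏ p ∈ N.primeFactors, f p := by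
  filter_upwards [eventually_gt_atTop N] with x hx
  rw [← Finset.prod_filter]
  refine Finset.prod_congr ?_ fun _ _ => rfl
  ext p
  simp only [Nat.primesBelow, Finset.mem_filter, Finset.mem_range, Nat.mem_primeFactors]
  constructor
  · rintro ⟨⟨-, hp⟩, h⟩; exact ⟨hp, h, NeZero.ne N⟩
  · rintro ⟨hp, h, -⟩
    exact ⟨⟨(Nat.le_of_dvd (NeZero.pos N) h).trans_lt hx, hp⟩, h⟩

lemma summable_inert_log_ratio {N : ℕ} (χ : DirichletCharacter ℝ N) {ε : ℝ} (hε : 0 < ε) :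
    Summable fun n : ℕ =>
      inertInd χ n * Real.log ((1 + (n : ℝ) ^ (-(1 + ε))) / (1 - (n : ℝ) ^ (-(1 + ε)))) := by
  simp_rw [inertInd_mul_log_ratio]
  exact (summable_inert_mul_rpow χ hε).add (summable_inertRemainder χ (by linarith))

lemma exp_tsum_inert_log_ratio {N : ℕ} [NeZero N] {χ : DirichletCharacter ℝ N}
    (hq : ∀ a, χ a = 0 ∨ χ a = 1 ∨ χ a = -1) {ε : ℝ} (hε : 0 < ε) :
    Real.exp (∑' n : ℕ,
        inertInd χ n * Real.log ((1 + (n : ℝ) ^ (-(1 + ε))) / (1 - (n : ℝ) ^ (-(1 + ε))))) *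
      ∑' n : ℕ, χ (n : ZMod N) * (n : ℝ) ^ (-(1 + ε)) =
    (∑' n : ℕ, 1 / (n : ℝ) ^ (1 + ε)) * ∏ p ∈ N.primeFactors, (1 - (p : ℝ) ^ (-(1 + ε))) := by
  have hs : 1 < 1 + ε := by linarith
  have h1 := ((Real.continuous_exp.tendsto _).comp
    (summable_inert_log_ratio χ hε).hasSum.tendsto_sum_nat).mul (tendsto_euler_prod_char χ hs)
  -- The character modulo 1 supplies the Euler product of `ζ`.
  have h2 := tendsto_euler_prod_char (1 : DirichletCharacter ℝ 1) hs
  have h3 : ∀ n : ℕ, (1 : DirichletCharacter ℝ 1) (n : ZMod 1) = 1 := fun n => by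
    rw [MulChar.one_apply]; exact isUnit_of_subsingleton _
  simp only [h3, one_mul] at h2
  have h4 := h2.mul (tendsto_const_nhds.congr'
    ((eventually_prod_primesBelow_dvd (N := N) fun p => 1 - (p : ℝ) ^ (-(1 + ε))).mono
      fun _ h => h.symm))
  have h5 := tendsto_nhds_unique (h1.congr fun x => exp_sum_inert_log_ratio hq hs x) h4
  rw [h5]
  congr 1
  exact tsum_congr fun n => by rw [Real.rpow_neg (by positivity), one_div]

/-- Mertens' product over the primes with `χ(p) = -1`, in logarithmic form. -/
theorem tendsto_sum_inert_log_ratio {N : ℕ} [NeZero N] {χ : DirichletCharacter ℝ N}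
    (hχ : χ ≠ 1) (hq : ∀ a, χ a = 0 ∨ χ a = 1 ∨ χ a = -1) {l : ℝ}
    (hl : Tendsto (fun n : ℕ => ∑ i ∈ Finset.Ioc 0 n, χ (i : ZMod N) * (i : ℝ)⁻¹) atTop (𝓝 l)) :
    Tendsto (fun x : ℕ => ∑ n ∈ Finset.Ioc 0 x,
        inertInd χ n * Real.log ((1 + (n : ℝ)⁻¹) / (1 - (n : ℝ)⁻¹)) - Real.log (Real.log x)) atTop
      (𝓝 (Real.eulerMascheroniConstant
        + Real.log ((∏ p ∈ N.primeFactors, (1 - (p : ℝ)⁻¹)) / l))) := by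
  obtain ⟨C, hC1, hC2⟩ := exists_inert_mertens hχ hq
  have hlpos := char_L_one_pos hχ hl
  have hPpos : 0 < ∏ p ∈ N.primeFactors, (1 - (p : ℝ)⁻¹) := Finset.prod_pos fun p hp => by
    have : (1 : ℝ) < p := by exact_mod_cast (Nat.prime_of_mem_primeFactors hp).one_lt
    exact sub_pos.2 (inv_lt_one_of_one_lt₀ this)
  set R := ∑' n, inertRemainder χ 1 n with hR
  have h1 : Tendsto (fun x : ℕ => ∑ n ∈ Finset.Ioc 0 x,
      inertInd χ n * Real.log ((1 + (n : ℝ)⁻¹) / (1 - (n : ℝ)⁻¹)) - Real.log (Real.log x)) atTop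
      (𝓝 (C + Real.eulerMascheroniConstant + R)) := by
    have hr : Tendsto (fun x : ℕ => ∑ n ∈ Finset.Ioc 0 x, inertRemainder χ 1 n) atTop (𝓝 R) := by
      refine ((summable_inertRemainder χ le_rfl).hasSum.tendsto_sum_nat.comp
        (tendsto_add_atTop_nat 1)).congr fun x => ?_
      exact sum_range_succ_eq_sum_Ioc _ (by simp [inertRemainder, inertInd_zero]) x
    refine (hC1.add hr).congr fun x => ?_
    have : ∀ n ∈ Finset.Ioc 0 x, inertInd χ n * Real.log ((1 + (n : ℝ)⁻¹) / (1 - (n : ℝ)⁻¹))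
        = inertInd χ n * (2 / (n : ℝ)) + inertRemainder χ 1 n := fun n _ => by
      simpa [Real.rpow_neg_one] using inertInd_mul_log_ratio χ 0 n
    rw [Finset.sum_congr rfl this, Finset.sum_add_distrib]
    ring
  have h2 : Tendsto (fun ε : ℝ => ∑' n : ℕ,
      inertInd χ n * Real.log ((1 + (n : ℝ) ^ (-(1 + ε))) / (1 - (n : ℝ) ^ (-(1 + ε))))
      + Real.log ε) (𝓝[>] 0) (𝓝 (C + R)) := by
    refine (hC2.add (tendsto_tsum_inertRemainder χ)).congr' ?_
    filter_upwards [self_mem_nhdsWithin] with ε hε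
    have hε : 0 < ε := hε
    simp_rw [inertInd_mul_log_ratio]
    rw [(summable_inert_mul_rpow χ hε).tsum_add (summable_inertRemainder χ (by linarith))]
    ring
  have hshift : Tendsto (fun ε : ℝ => 1 + ε) (𝓝[>] 0) (𝓝[>] 1) := by
    refine tendsto_nhdsWithin_iff.2 ⟨?_, ?_⟩
    · have : ContinuousAt (fun ε : ℝ => 1 + ε) 0 := by fun_prop
      simpa using this.tendsto.mono_left nhdsWithin_le_nhds
    · filter_upwards [self_mem_nhdsWithin] with ε hε
      simpa using hε
  have h3 : Tendsto (fun ε : ℝ => ε * ∑' n : ℕ, 1 / (n : ℝ) ^ (1 + ε)) (𝓝[>] 0) (𝓝 1) := by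
    simpa [Function.comp_def] using tendsto_sub_mul_tsum_nat_rpow.comp hshift
  have h4 : Tendsto (fun ε : ℝ => ∏ p ∈ N.primeFactors, (1 - (p : ℝ) ^ (-(1 + ε)))) (𝓝[>] 0)
      (𝓝 (∏ p ∈ N.primeFactors, (1 - (p : ℝ)⁻¹))) := by
    refine tendsto_finsetProd _ fun p hp => ?_
    have hp0 : (p : ℝ) ≠ 0 := by
      exact_mod_cast (Nat.prime_of_mem_primeFactors hp).ne_zero
    have : ContinuousAt (fun ε : ℝ => 1 - (p : ℝ) ^ (-(1 + ε))) 0 := by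
      fun_prop (disch := assumption)
    simpa [Real.rpow_neg_one] using this.tendsto.mono_left nhdsWithin_le_nhds
  have h5 := (Real.continuous_exp.tendsto _).comp h2
  have h6 : Tendsto (fun ε : ℝ => Real.exp (∑' n : ℕ,
      inertInd χ n * Real.log ((1 + (n : ℝ) ^ (-(1 + ε))) / (1 - (n : ℝ) ^ (-(1 + ε))))
      + Real.log ε)) (𝓝[>] 0) (𝓝 ((∏ p ∈ N.primeFactors, (1 - (p : ℝ)⁻¹)) / l)) := by
    have h7 := (h3.mul h4).div (tendsto_tsum_charPow hl) hlpos.ne'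
    rw [one_mul] at h7
    refine h7.congr' ?_
    filter_upwards [self_mem_nhdsWithin,
      (tendsto_tsum_charPow hl).eventually_const_lt hlpos] with ε hε hεl
    have hε : 0 < ε := hε
    simp only [Pi.div_apply]
    rw [Real.exp_add, Real.exp_log hε, div_eq_iff hεl.ne', mul_assoc,
      ← exp_tsum_inert_log_ratio hq hε]
    ring
  -- The damped sum has two evaluations as `ε → 0`, one through `C + R` and one through `ε ζ(1 + ε)
  -- → 1`; this pins down the constant.
  have h8 : Real.exp (C + R) = (∏ p ∈ N.primeFactors, (1 - (p : ℝ)⁻¹)) / l :=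
    tendsto_nhds_unique h5 h6
  rw [← h8, Real.log_exp]
  convert h1 using 2
  ring

end Inert

/-! ### The character `(-d / ·)` modulo `4d` and the constants of Shanks' formula -/

section JacobiCharacter

lemma jacobiSym_neg_mod_right (d : ℕ) {m : ℕ} (hm : Odd m) :
    jacobiSym (-(d : ℤ)) (m % (4 * d)) = jacobiSym (-(d : ℤ)) m := by
  have := jacobiSym.mod_right (-(d : ℤ)) hm
  rw [Int.natAbs_neg, Int.natAbs_natCast] at this
  exact this.symm

/-- The value `(-d / m)` for odd `m`, and `0` for even `m`. -/
def oddJacobi (d m : ℕ) : ℤ := if Odd m then jacobiSym (-(d : ℤ)) m else 0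

lemma oddJacobi_mod (d m : ℕ) : oddJacobi d (m % (4 * d)) = oddJacobi d m := by
  have h : Odd (m % (4 * d)) ↔ Odd m := by
    rw [Nat.odd_iff, Nat.odd_iff, Nat.mod_mod_of_dvd m (Dvd.intro (2 * d) (by ring))]
  unfold oddJacobi
  by_cases hm : Odd m
  · rw [if_pos (h.2 hm), if_pos hm, jacobiSym_neg_mod_right d hm]
  · rw [if_neg (fun h' => hm (h.1 h')), if_neg hm]

lemma oddJacobi_mul (d m n : ℕ) : oddJacobi d (m * n) = oddJacobi d m * oddJacobi d n := by
  unfold oddJacobi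
  by_cases hm : Odd m
  · by_cases hn : Odd n
    · have : NeZero m := ⟨by rintro rfl; simp at hm⟩
      have : NeZero n := ⟨by rintro rfl; simp at hn⟩
      rw [if_pos hm, if_pos hn, if_pos (hm.mul hn), jacobiSym.mul_right]
    · rw [if_neg hn, if_neg (fun h => hn (Nat.odd_mul.1 h).2), mul_zero]
  · rw [if_neg hm, if_neg (fun h => hm (Nat.odd_mul.1 h).1), zero_mul]

/-- The Dirichlet character modulo `4d` given by `m ↦ (-d / m)` on odd `m`. -/
noncomputable def oddJacobiChar (d : ℕ) [NeZero d] : DirichletCharacter ℝ (4 * d) where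
  toFun a := oddJacobi d a.val
  map_one' := by
    have : oddJacobi d ((1 : ℕ) : ZMod (4 * d)).val = 1 := by
      rw [ZMod.val_natCast, oddJacobi_mod]
      simp [oddJacobi]
    rw [Nat.cast_one] at this
    rw [this, Int.cast_one]
  map_mul' a b := by
    rw [ZMod.val_mul, oddJacobi_mod, oddJacobi_mul, Int.cast_mul]
  map_nonunit' a ha := by
    have h : oddJacobi d a.val = 0 := by
      unfold oddJacobi
      split_ifs with hodd
      · have : NeZero a.val := ⟨fun h => by rw [h] at hodd; simp at hodd⟩
        rw [jacobiSym.eq_zero_iff_not_coprime]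
        intro hc
        refine ha ?_
        rw [← ZMod.natCast_zmod_val a, ZMod.isUnit_iff_coprime]
        refine Nat.Coprime.mul_right ?_ ?_
        · exact (Nat.Coprime.pow_right 2 (Nat.coprime_two_right.2 hodd) : Nat.Coprime _ (2 ^ 2))
        · rw [Int.neg_gcd, Int.gcd_natCast_natCast] at hc
          exact (Nat.coprime_comm.1 hc)
      · rfl
    simp [h]

lemma oddJacobiChar_natCast (d : ℕ) [NeZero d] (n : ℕ) :
    oddJacobiChar d (n : ZMod (4 * d)) = oddJacobi d n := by
  change ((oddJacobi d ((n : ℕ) : ZMod (4 * d)).val : ℤ) : ℝ) = _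
  rw [ZMod.val_natCast, oddJacobi_mod]

lemma oddJacobiChar_trichotomy (d : ℕ) [NeZero d] (a : ZMod (4 * d)) :
    oddJacobiChar d a = 0 ∨ oddJacobiChar d a = 1 ∨ oddJacobiChar d a = -1 := by
  rw [← ZMod.natCast_zmod_val a, oddJacobiChar_natCast]
  unfold oddJacobi
  split_ifs
  · rcases jacobiSym.trichotomy (-(d : ℤ)) a.val with h | h | h <;> simp [h]
  · simp

lemma oddJacobiChar_ne_one {d m : ℕ} [NeZero d] (hm : oddJacobi d m = -1) :
    oddJacobiChar d ≠ 1 := by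
  intro h
  have h1 := oddJacobiChar_natCast d m
  rw [h, hm] at h1
  by_cases hu : IsUnit (m : ZMod (4 * d))
  · rw [MulChar.one_apply hu] at h1; norm_num at h1
  · rw [MulChar.map_nonunit _ hu] at h1; norm_num at h1

lemma oddLPartialSum_eq (d : ℕ) [NeZero d] (n : ℕ) :
    oddLPartialSum d n =
      ∑ i ∈ Finset.Ioc 0 n, oddJacobiChar d (i : ZMod (4 * d)) * (i : ℝ)⁻¹ := by
  rw [oddLPartialSum, Finset.sum_filter]
  refine Finset.sum_congr rfl fun i _ => ?_
  rw [oddJacobiChar_natCast, oddJacobi]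
  split_ifs <;> simp [div_eq_mul_inv]

lemma tendsto_oddLPartialSum {d m : ℕ} [NeZero d] (hm : oddJacobi d m = -1) :
    Tendsto (oddLPartialSum d) atTop (𝓝 (oddL d)) := by
  obtain ⟨l, hl, -⟩ := exists_char_L_one (oddJacobiChar_ne_one hm)
  refine tendsto_nhds_limUnder ⟨l, hl.congr fun n => (oddLPartialSum_eq d n).symm⟩

lemma oddL_pos {d m : ℕ} [NeZero d] (hm : oddJacobi d m = -1) : 0 < oddL d :=
  char_L_one_pos (oddJacobiChar_ne_one hm)
    ((tendsto_oddLPartialSum hm).congr fun n => oddLPartialSum_eq d n)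

/-- `p` is an odd prime with `(-d / p) = -1`. -/
def IsInert (d p : ℕ) : Prop := p.Prime ∧ Odd p ∧ jacobiSym (-(d : ℤ)) p = -1

open Classical in
lemma inertInd_oddJacobiChar (d : ℕ) [NeZero d] (n : ℕ) :
    inertInd (oddJacobiChar d) n = if IsInert d n then 1 else 0 := by
  have hiff : (n.Prime ∧ oddJacobiChar d (n : ZMod (4 * d)) = -1) ↔ IsInert d n := by
    refine and_congr_right fun _ => ?_
    rw [oddJacobiChar_natCast, oddJacobi]
    split_ifs with h
    · simp only [h, true_and]; norm_cast
    · simp [h]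
  unfold inertInd
  by_cases h : IsInert d n
  · rw [if_pos h, if_pos (hiff.2 h)]
  · rw [if_neg h, if_neg (fun h' => h (hiff.1 h'))]

/-- `4d` and `2d` have the same prime factors, so the factor at the modulus `4d` becomes the
`φ(2d)/(2d)` of Shanks' formula. -/
lemma prod_primeFactors_one_sub_inv {d : ℕ} (hd : d ≠ 0) :
    ∏ p ∈ (4 * d).primeFactors, (1 - (p : ℝ)⁻¹) = (Nat.totient (2 * d) : ℝ) / ((2 * d : ℕ) : ℝ) := by
  have h1 : (4 * d).primeFactors = (2 * d).primeFactors := by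
    rw [Nat.primeFactors_mul (by norm_num) hd, Nat.primeFactors_mul (by norm_num) hd,
      show (4 : ℕ) = 2 ^ 2 by norm_num, Nat.primeFactors_pow 2 (by norm_num)]
  have h2 := Nat.totient_eq_mul_prod_factors (2 * d)
  have h3 : ((Nat.totient (2 * d) : ℚ) : ℝ)
      = ((2 * d : ℕ) : ℝ) * ∏ p ∈ (2 * d).primeFactors, (1 - (p : ℝ)⁻¹) := by
    rw [h2]; push_cast; rfl
  rw [h1, eq_div_iff (by positivity), mul_comm, ← h3]
  simp

/-- The logarithm of the Euler factor of `g_d`, extended by zero. -/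
noncomputable def logGFactor (d : ℕ) [NeZero d] (n : ℕ) : ℝ :=
  inertInd (oddJacobiChar d) n * (-(1 / 2) * Real.log (1 - ((n : ℝ) ^ 2)⁻¹))

lemma summable_logGFactor (d : ℕ) [NeZero d] : Summable (logGFactor d) := by
  refine Summable.of_norm_bounded
    (g := fun n : ℕ => ((n : ℝ) ^ 2)⁻¹) (Real.summable_nat_pow_inv.2 (by norm_num)) fun n => ?_
  rw [logGFactor, norm_mul, Real.norm_of_nonneg (inertInd_nonneg _ n)]
  rcases lt_or_ge n 2 with hn | hn
  · rw [inertInd_eq_zero_of_lt_two _ hn, zero_mul]; positivity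
  have hn' : (2 : ℝ) ≤ n := by exact_mod_cast hn
  have ht0 : 0 ≤ ((n : ℝ) ^ 2)⁻¹ := by positivity
  have ht : ((n : ℝ) ^ 2)⁻¹ ≤ 1 / 4 := by
    rw [one_div]; exact inv_anti₀ (by norm_num) (by nlinarith)
  refine (mul_le_of_le_one_left (norm_nonneg _) (inertInd_le_one _ n)).trans ?_
  set t := ((n : ℝ) ^ 2)⁻¹
  have h1 := Real.log_nonpos (show 0 ≤ 1 - t by linarith) (by linarith)
  have h2 := Real.one_sub_inv_le_log_of_pos (show 0 < 1 - t by linarith)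
  have h3 : (1 - t)⁻¹ ≤ 1 + 2 * t := by
    rw [inv_le_iff_one_le_mul₀ (by linarith)]; nlinarith
  rw [Real.norm_of_nonneg (by linarith)]
  linarith

lemma gFactor_eq_exp (d : ℕ) [NeZero d] (p : InertPrime d) :
    gFactor d p = Real.exp (logGFactor d p.1) := by
  have hp : (1 : ℝ) < p.1 := by exact_mod_cast p.2.1.one_lt
  have h : 0 < 1 - ((p.1 : ℝ) ^ 2)⁻¹ :=
    sub_pos.2 (inv_lt_one_of_one_lt₀ (one_lt_pow₀ hp (by norm_num)))
  have h1 : inertInd (oddJacobiChar d) p.1 = 1 := by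
    classical
    rw [inertInd_oddJacobiChar, if_pos (show IsInert d p.1 from p.2)]
  rw [gFactor, logGFactor, h1, one_mul, Real.rpow_def_of_pos h, mul_comm]

lemma hasProd_gFactor (d : ℕ) [NeZero d] :
    HasProd (gFactor d) (Real.exp (∑' n, logGFactor d n)) := by
  have h1 : HasSum (fun p : InertPrime d => logGFactor d p.1) (∑' n, logGFactor d n) := by
    refine (Function.Injective.hasSum_iff (g := fun p : InertPrime d => p.1)
      Subtype.val_injective fun n hn => ?_).2 (summable_logGFactor d).hasSum
    have : ¬ IsInert d n := fun h => hn ⟨⟨n, h⟩, rfl⟩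
    classical
    rw [logGFactor, inertInd_oddJacobiChar, if_neg this, zero_mul]
  rw [show gFactor d = fun p => Real.exp (logGFactor d p.1) from funext (gFactor_eq_exp d)]
  exact h1.rexp

lemma gConst_eq_exp (d : ℕ) [NeZero d] : gConst d = Real.exp (∑' n, logGFactor d n) :=
  (hasProd_gFactor d).tprod_eq

open Classical in
/-- The primes `q ≤ x` that are inert for `d`. -/
noncomputable def inertPrimes (d x : ℕ) : Finset ℕ := (Finset.Icc 1 x).filter (IsInert d)

/-- Uses `log (1 + t)⁻¹ = -(1/2) log (1 - t²) - (1/2) log ((1 + t)/(1 - t))`: the first part sums to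
`log g_d`, and the second is Mertens' product. The witness `m` ensures that the character is
nontrivial. -/
theorem tendsto_prod_inertPrimes {d m : ℕ} [NeZero d] (hm : oddJacobi d m = -1) :
    Tendsto (fun x : ℕ => (∏ q ∈ inertPrimes d x, (1 + (q : ℝ)⁻¹)⁻¹) * Real.sqrt (Real.log x))
      atTop (𝓝 (gConst d * Real.sqrt (oddL d * ((2 * d : ℕ) : ℝ) /
        (Nat.totient (2 * d) : ℝ) * Real.exp (-Real.eulerMascheroniConstant)))) := by
  have hd : d ≠ 0 := NeZero.ne d
  have hL := oddL_pos hm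
  have hφ : (0 : ℝ) < Nat.totient (2 * d) := by
    exact_mod_cast Nat.totient_pos.2 (by omega)
  have hd2 : (0 : ℝ) < ((2 * d : ℕ) : ℝ) := by exact_mod_cast (by omega)
  have h1 := tendsto_sum_inert_log_ratio (oddJacobiChar_ne_one hm) (oddJacobiChar_trichotomy d)
    ((tendsto_oddLPartialSum hm).congr fun n => oddLPartialSum_eq d n)
  have h2 : Tendsto (fun x : ℕ => ∑ n ∈ Finset.Ioc 0 x, logGFactor d n) atTop
      (𝓝 (∑' n, logGFactor d n)) := by
    refine ((summable_logGFactor d).hasSum.tendsto_sum_nat.comp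
      (tendsto_add_atTop_nat 1)).congr fun x => ?_
    exact sum_range_succ_eq_sum_Ioc _ (by simp [logGFactor, inertInd_zero]) x
  have h3 := (Real.continuous_exp.tendsto _).comp (h2.sub (h1.const_mul (1 / 2)))
  rw [Real.exp_sub, ← gConst_eq_exp, prod_primeFactors_one_sub_inv hd] at h3
  have e : gConst d / Real.exp (1 / 2 * (Real.eulerMascheroniConstant +
      Real.log ((Nat.totient (2 * d) : ℝ) / ((2 * d : ℕ) : ℝ) / oddL d)))
      = gConst d * Real.sqrt (oddL d * ((2 * d : ℕ) : ℝ) /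
        (Nat.totient (2 * d) : ℝ) * Real.exp (-Real.eulerMascheroniConstant)) := by
    rw [div_eq_mul_inv, ← Real.exp_neg]
    congr 1
    rw [← Real.exp_log (Real.sqrt_pos.2 (by positivity)), Real.log_sqrt (by positivity),
      Real.log_mul (by positivity) (by positivity), Real.log_exp, Real.log_div (by positivity)
      (by positivity), Real.log_div (by positivity) (by positivity), Real.log_div (by positivity)
      (by positivity), Real.log_mul (by positivity) (by positivity)]
    congr 1; ring
  rw [e] at h3
  refine h3.congr' ?_
  filter_upwards [eventually_ge_atTop 2] with x hx
  have hx1 : 0 < Real.log x := Real.log_pos (by exact_mod_cast hx)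
  simp only [Function.comp]
  rw [mul_sub, ← sub_add, Real.exp_add, Finset.mul_sum, ← Finset.sum_sub_distrib, Real.exp_sum]
  congr 1
  · rw [inertPrimes, Finset.prod_filter]
    refine Finset.prod_congr rfl fun n _ => ?_
    classical
    rw [logGFactor, inertInd_oddJacobiChar]
    split_ifs with h
    · have hn : (1 : ℝ) < n := by exact_mod_cast h.1.one_lt
      have hi : (n : ℝ)⁻¹ < 1 := inv_lt_one_of_one_lt₀ hn
      have hi0 : 0 < (n : ℝ)⁻¹ := by positivity
      have : 1 - ((n : ℝ) ^ 2)⁻¹ = (1 + (n : ℝ)⁻¹) * (1 - (n : ℝ)⁻¹) := by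
        field_simp; ring
      rw [← Real.exp_log (show 0 < (1 + (n : ℝ)⁻¹)⁻¹ by positivity), this,
        Real.log_mul (by linarith) (by linarith), Real.log_div (by linarith) (by linarith),
        Real.log_inv]
      congr 1; ring
    · simp
  · rw [← Real.exp_log (Real.sqrt_pos.2 hx1), Real.log_sqrt hx1.le]
    congr 1; ring

end JacobiCharacter

/-! ### Hensel lifting of square ratios -/

section Lifting

/-- `a / b` is a unit congruent to 1 mod `p`, hence a `p`-adic square; proved by Newton iteration.
-/
lemma exists_sq_mul_lift_odd {p : ℕ} (hp : p.Prime) (hp2 : p ≠ 2) {a b : ℤ} (ha : ¬ (p : ℤ) ∣ a)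
    (hab : (p : ℤ) ∣ a - b) (k : ℕ) : ∃ t : ℤ, (p : ℤ) ^ k ∣ a - b * t ^ 2 := by
  rcases Nat.eq_zero_or_pos k with rfl | hk
  · exact ⟨0, by simp⟩
  have hpp : Prime (p : ℤ) := Nat.prime_iff_prime_int.1 hp
  have h2 : ¬ (p : ℤ) ∣ 2 := fun h => by
    have := (Nat.prime_dvd_prime_iff_eq hp Nat.prime_two).1 (by exact_mod_cast h)
    exact hp2 this
  induction k, hk using Nat.le_induction with
  | base => exact ⟨1, by simpa using hab⟩
  | succ k hk ih =>
    obtain ⟨t, e, he⟩ := ih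
    have hk1 : (p : ℤ) ∣ p ^ k := dvd_pow_self _ (by omega)
    have hbt : ¬ (p : ℤ) ∣ 2 * b * t := by
      intro h
      rcases hpp.dvd_or_dvd h with h | h
      · rcases hpp.dvd_or_dvd h with h | h
        · exact h2 h
        · exact ha ((dvd_sub_left h).1 hab)
      · refine ha ?_
        have h3 : a = p ^ k * e + b * t ^ 2 := by linarith
        rw [h3]
        exact dvd_add (hk1.mul_right e) ((h.pow two_ne_zero).mul_left b)
    obtain ⟨u, v, huv⟩ := (hpp.coprime_iff_not_dvd.2 hbt)
    have hkk : (p : ℤ) ^ (k + 1) ∣ p ^ k * p ^ k := by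
      rw [← pow_add]; exact pow_dvd_pow _ (by omega)
    -- `v` inverts `2 b t` modulo `p`, so this correction cancels the error `p ^ k * e` to one more
    -- order.
    refine ⟨t + p ^ k * (v * e), ?_⟩
    have h4 : a - b * (t + p ^ k * (v * e)) ^ 2
        = p ^ (k + 1) * (u * e) - p ^ k * p ^ k * (b * (v * e) ^ 2) := by
      have h5 : a = p ^ k * e + b * t ^ 2 := by linarith
      rw [h5]
      linear_combination (-(p : ℤ) ^ k * e) * huv
    rw [h4]
    exact dvd_sub (Dvd.intro _ rfl) (hkk.mul_right _)

lemma exists_sq_mul_lift_two {a b : ℤ} (ha : Odd a) (hab : (8 : ℤ) ∣ a - b) (k : ℕ) :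
    ∃ t : ℤ, (2 : ℤ) ^ k ∣ a - b * t ^ 2 := by
  have hb : Odd b := by
    obtain ⟨c, hc⟩ := hab
    obtain ⟨i, hi⟩ := ha
    exact ⟨i - 4 * c, by linarith⟩
  rcases le_or_gt k 3 with hk | hk
  · exact ⟨1, by simpa using (pow_dvd_pow 2 hk).trans (by simpa using hab)⟩
  induction k, hk.le using Nat.le_induction with
  | base => omega
  | succ k hk3 ih =>
    have ih' : ∃ t : ℤ, (2 : ℤ) ^ k ∣ a - b * t ^ 2 := by
      rcases Nat.lt_or_ge 3 k with h | h
      · exact ih h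
      · obtain rfl : k = 3 := by omega
        exact ⟨1, by simpa using hab⟩
    obtain ⟨t, e, he⟩ := ih'
    obtain ⟨j, rfl⟩ : ∃ j, k = j + 3 := ⟨k - 3, by omega⟩
    rcases Int.even_or_odd e with ⟨f, hf⟩ | ⟨f, hf⟩
    · exact ⟨t, f, by rw [he, hf]; ring⟩
    · have ht : Odd t := by
        by_contra h
        rw [Int.not_odd_iff_even] at h
        obtain ⟨c, hc⟩ := h
        obtain ⟨i, hi⟩ := ha
        rw [hi, hc] at he
        have : (1 : ℤ) = 2 * (2 ^ (j + 2) * e + 2 * b * c ^ 2 - i) := by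
          have h3 : (2 : ℤ) ^ (j + 3) = 2 * 2 ^ (j + 2) := by ring
          rw [h3] at he
          linarith
        omega
      obtain ⟨g, hg⟩ := hb.mul ht
      -- With `k = j + 3`, shifting `t` by `2 ^ (k - 1)` changes `b t²` by `2 ^ k` times the odd
      -- number `b t`, modulo `2 ^ (k + 1)`, so the odd error `e` becomes even.
      refine ⟨t + 2 ^ (j + 2), f - g - b * 2 ^ j, ?_⟩
      have h5 : a = 2 ^ (j + 3) * e + b * t ^ 2 := by linarith
      rw [h5, hf]
      have h6 : (2 : ℤ) ^ (j + 3) * (b * t) = 2 ^ (j + 3) * (2 * g + 1) := by rw [hg]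
      linear_combination -h6

end Lifting

/-! ### Counting represented residues: units, descent, recursion -/

section Residues

/-- The integer `a` is represented by `x² + d y²` modulo `m`. -/
def RepMod (d m : ℕ) (a : ℤ) : Prop := ∃ x y : ℤ, (m : ℤ) ∣ x ^ 2 + d * y ^ 2 - a

lemma RepMod.of_dvd {d m n : ℕ} {a : ℤ} (h : RepMod d n a) (hmn : m ∣ n) : RepMod d m a := by
  obtain ⟨x, y, hxy⟩ := h
  exact ⟨x, y, (Int.natCast_dvd_natCast.2 hmn).trans hxy⟩

lemma RepMod.congr {d m : ℕ} {a b : ℤ} (h : RepMod d m a) (hab : (m : ℤ) ∣ a - b) :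
    RepMod d m b := by
  obtain ⟨x, y, hxy⟩ := h
  exact ⟨x, y, by have := dvd_add hxy hab; rwa [sub_add_sub_cancel] at this⟩

/-- The form is homogeneous: scaling `(x, y)` by `t` multiplies its value by `t²`, so only a square
ratio has to be lifted. -/
lemma RepMod.lift {d m n : ℕ} {a : ℤ} (h : RepMod d m a)
    (H : ∀ b : ℤ, (m : ℤ) ∣ a - b → ∃ t : ℤ, (n : ℤ) ∣ a - b * t ^ 2) : RepMod d n a := by
  obtain ⟨x, y, hxy⟩ := h
  obtain ⟨t, ht⟩ := H _ (by rw [← dvd_neg, neg_sub]; exact hxy)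
  refine ⟨t * x, t * y, ?_⟩
  rw [show (t * x) ^ 2 + d * (t * y) ^ 2 - a = -(a - (x ^ 2 + d * y ^ 2) * t ^ 2) by ring, dvd_neg]
  exact ht

lemma RepMod.lift_odd {d p : ℕ} (hp : p.Prime) (hp2 : p ≠ 2) {a : ℤ} (ha : ¬ (p : ℤ) ∣ a)
    (h : RepMod d (p ^ 1) a) (k : ℕ) : RepMod d (p ^ k) a := by
  rw [pow_one] at h
  refine h.lift fun b hb => ?_
  rw [Nat.cast_pow]
  exact exists_sq_mul_lift_odd hp hp2 ha hb k

lemma RepMod.lift_two {d : ℕ} {a : ℤ} (ha : ¬ ((2 : ℕ) : ℤ) ∣ a) (h : RepMod d (2 ^ 3) a) (k : ℕ) :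
    RepMod d (2 ^ k) a := by
  refine h.lift fun b hb => ?_
  rw [Nat.cast_pow]
  exact exists_sq_mul_lift_two (Int.not_even_iff_odd.1 fun h => ha h.two_dvd)
    (by simpa using hb) k

open Classical in
/-- The number of residues modulo `m` represented by `x² + d y²`. -/
noncomputable def repCount (d m : ℕ) : ℕ := ((Finset.range m).filter fun a : ℕ => RepMod d m a).card

lemma ncard_representedResidues (d p k : ℕ) (hp : p ≠ 0) :
    (representedResidues d p k).ncard = repCount d (p ^ k) := by
  classical
  have : NeZero (p ^ k) := ⟨pow_ne_zero _ hp⟩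
  have himg : representedResidues d p k = (fun a : ℕ => (a : ZMod (p ^ k))) ''
      (((Finset.range (p ^ k)).filter fun a : ℕ => RepMod d (p ^ k) a : Finset ℕ) : Set ℕ) := by
    ext a
    simp only [representedResidues, Set.mem_ofPred_eq, Set.mem_image, Finset.coe_filter,
      Finset.mem_range]
    constructor
    · rintro ⟨x, y, rfl⟩
      refine ⟨(x ^ 2 + (d : ZMod (p ^ k)) * y ^ 2).val, ⟨ZMod.val_lt _, x.val, y.val, ?_⟩, by simp⟩
      rw [← ZMod.intCast_zmod_eq_zero_iff_dvd]
      push_cast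
      simp
    · rintro ⟨n, ⟨-, x, y, h⟩, rfl⟩
      refine ⟨x, y, ?_⟩
      have := (ZMod.intCast_zmod_eq_zero_iff_dvd _ _).2 h
      push_cast at this
      exact (sub_eq_zero.1 this).symm
  rw [himg, Set.InjOn.ncard_image, Set.ncard_coe_finset]
  · rfl
  · intro a ha b hb hab
    simp only [Finset.coe_filter, Finset.mem_range, Set.mem_ofPred_eq] at ha hb
    have := congrArg ZMod.val hab
    simpa [ZMod.val_cast_of_lt ha.1, ZMod.val_cast_of_lt hb.1] using this

lemma residueDensity_eq (d p k : ℕ) (hp : p ≠ 0) :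
    residueDensity d p k = (repCount d (p ^ k) : ℝ) / (p : ℝ) ^ k := by
  rw [residueDensity, ncard_representedResidues d p k hp]

lemma card_filter_range_mul (p m : ℕ) (hp : 0 < p) (P : ℕ → Prop) [DecidablePred P] :
    ((Finset.range (p * m)).filter P).card =
      ((Finset.range (p * m)).filter fun a => ¬ p ∣ a ∧ P a).card +
        ((Finset.range m).filter fun b => P (p * b)).card := by
  rw [← Finset.card_filter_add_card_filter_not (fun a => ¬ p ∣ a), Finset.filter_filter,
    Finset.filter_filter]
  congr 1
  · congr 1; ext a; simp [and_comm]
  · rw [← Finset.card_image_of_injective ((Finset.range m).filter fun b => P (p * b))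
      (f := fun b => p * b) (fun a b h => Nat.eq_of_mul_eq_mul_left hp h)]
    congr 1
    ext a
    simp only [Finset.mem_filter, Finset.mem_range, not_not, Finset.mem_image]
    constructor
    · rintro ⟨h1, h2, b, rfl⟩
      exact ⟨b, ⟨Nat.lt_of_mul_lt_mul_left h1, h2⟩, rfl⟩
    · rintro ⟨b, ⟨h1, h2⟩, rfl⟩
      exact ⟨Nat.mul_lt_mul_of_pos_left h1 hp, h2, Dvd.intro _ rfl⟩

lemma card_filter_range_periodic (M j : ℕ) (P : ℕ → Prop) [DecidablePred P]
    (hP : ∀ a, P (M + a) ↔ P a) :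
    ((Finset.range (M * j)).filter P).card = j * ((Finset.range M).filter P).card := by
  have hP' : ∀ i a, P (M * i + a) ↔ P a := by
    intro i a
    induction i with
    | zero => simp
    | succ i ih => rw [show M * (i + 1) + a = M + (M * i + a) by ring, hP, ih]
  induction j with
  | zero => simp
  | succ j ih =>
    rw [Finset.card_filter] at *
    rw [Nat.mul_succ, Finset.sum_range_add, ih, Nat.succ_mul, Finset.card_filter]
    simp only [hP']

open Classical in
/-- The number of residues modulo `p ^ k₀` prime to `p` and represented by `x² + d y²`. -/
noncomputable def unitCount (d p k₀ : ℕ) : ℕ :=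
  ((Finset.range (p ^ k₀)).filter fun a : ℕ => ¬ p ∣ a ∧ RepMod d (p ^ k₀) a).card

open Classical in
-- Under `H`, whether a residue prime to `p` is represented depends only on its class modulo `p ^
-- k₀`. In the applications `k₀` is 1 for odd `p` and 3 for `p = 2`.
lemma card_units_represented {d p k₀ k : ℕ} (hk : k₀ ≤ k) (hk0 : k₀ ≠ 0)
    (H : ∀ a : ℤ, ¬ (p : ℤ) ∣ a → RepMod d (p ^ k₀) a → RepMod d (p ^ k) a) :
    ((Finset.range (p ^ k)).filter fun a : ℕ => ¬ p ∣ a ∧ RepMod d (p ^ k) a).card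
      = p ^ (k - k₀) * unitCount d p k₀ := by
  have h1 : ∀ a : ℕ, (¬ p ∣ a ∧ RepMod d (p ^ k) a) ↔ (¬ p ∣ a ∧ RepMod d (p ^ k₀) a) := fun a =>
    and_congr_right fun ha =>
      ⟨fun h => h.of_dvd (pow_dvd_pow _ hk), fun h => H a (by exact_mod_cast ha) h⟩
  simp only [h1]
  rw [show p ^ k = p ^ k₀ * p ^ (k - k₀) by rw [← pow_add]; congr 1; omega,
    card_filter_range_periodic, unitCount]
  intro a
  have h2 : p ∣ p ^ k₀ := dvd_pow_self _ hk0
  rw [Nat.dvd_add_right h2]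
  refine and_congr_right fun _ => ⟨fun h => h.congr ?_, fun h => h.congr ?_⟩
  · push_cast; simp
  · push_cast; simp

/-- The values of `x² + d y²` divisible by `p` are the `p`-multiples of its values. -/
def DescentOne (d p : ℕ) : Prop :=
  (∀ x y : ℤ, (p : ℤ) ∣ x ^ 2 + d * y ^ 2 →
    ∃ u v : ℤ, x ^ 2 + d * y ^ 2 = p * (u ^ 2 + d * v ^ 2)) ∧
  ∀ u v : ℤ, ∃ x y : ℤ, x ^ 2 + d * y ^ 2 = p * (u ^ 2 + d * v ^ 2)

/-- The values of `x² + d y²` divisible by `p` are the `p²`-multiples of values of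
`x² + d' y²`. -/
def DescentTwo (d d' p : ℕ) : Prop :=
  (∀ x y : ℤ, (p : ℤ) ∣ x ^ 2 + d * y ^ 2 →
    ∃ u v : ℤ, x ^ 2 + d * y ^ 2 = p ^ 2 * (u ^ 2 + d' * v ^ 2)) ∧
  ∀ u v : ℤ, ∃ x y : ℤ, x ^ 2 + d * y ^ 2 = p ^ 2 * (u ^ 2 + d' * v ^ 2)

lemma DescentOne.repMod_iff {d p : ℕ} (h : DescentOne d p) (hp : p ≠ 0) (k : ℕ) (b : ℤ) :
    RepMod d (p ^ (k + 1)) (p * b) ↔ RepMod d (p ^ k) b := by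
  have hp' : (p : ℤ) ≠ 0 := by exact_mod_cast hp
  constructor
  · rintro ⟨x, y, hxy⟩
    have h1 : (p : ℤ) ∣ x ^ 2 + d * y ^ 2 := by
      have := (show (p : ℤ) ∣ ((p ^ (k + 1) : ℕ) : ℤ) by
        push_cast; exact dvd_pow_self _ (by omega)).trans hxy
      exact (dvd_sub_left (Dvd.intro _ rfl)).1 this
    obtain ⟨u, v, huv⟩ := h.1 x y h1
    refine ⟨u, v, ?_⟩
    rw [huv, ← mul_sub] at hxy
    push_cast at hxy ⊢
    rw [pow_succ'] at hxy
    exact (mul_dvd_mul_iff_left hp').1 hxy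
  · rintro ⟨u, v, huv⟩
    obtain ⟨x, y, hxy⟩ := h.2 u v
    refine ⟨x, y, ?_⟩
    rw [hxy, ← mul_sub]
    push_cast at huv ⊢
    rw [pow_succ']
    exact mul_dvd_mul_left _ huv

lemma DescentTwo.dvd_of_repMod {d d' p : ℕ} (h : DescentTwo d d' p) (hp : p ≠ 0) {k : ℕ} {b : ℤ}
    (hr : RepMod d (p ^ (k + 2)) (p * b)) : (p : ℤ) ∣ b := by
  have hp' : (p : ℤ) ≠ 0 := by exact_mod_cast hp
  obtain ⟨x, y, hxy⟩ := hr
  have h2 : (p : ℤ) ^ 2 ∣ x ^ 2 + d * y ^ 2 - p * b := by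
    refine (show (p : ℤ) ^ 2 ∣ ((p ^ (k + 2) : ℕ) : ℤ) from ?_).trans hxy
    push_cast; exact pow_dvd_pow _ (by omega)
  have h1 : (p : ℤ) ∣ x ^ 2 + d * y ^ 2 :=
    (dvd_sub_left (Dvd.intro _ rfl)).1 ((dvd_pow_self _ two_ne_zero).trans h2)
  obtain ⟨u, v, huv⟩ := h.1 x y h1
  rw [huv, dvd_sub_right (Dvd.intro _ rfl), pow_two] at h2
  exact (mul_dvd_mul_iff_left hp').1 h2

lemma DescentTwo.repMod_iff {d d' p : ℕ} (h : DescentTwo d d' p) (hp : p ≠ 0) (k : ℕ) (b : ℤ) :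
    RepMod d (p ^ (k + 2)) (p * (p * b)) ↔ RepMod d' (p ^ k) b := by
  have hp' : (p : ℤ) ^ 2 ≠ 0 := by exact_mod_cast pow_ne_zero 2 hp
  constructor
  · rintro ⟨x, y, hxy⟩
    have h1 : (p : ℤ) ∣ x ^ 2 + d * y ^ 2 := by
      have := (show (p : ℤ) ∣ ((p ^ (k + 2) : ℕ) : ℤ) by
        push_cast; exact dvd_pow_self _ (by omega)).trans hxy
      exact (dvd_sub_left (Dvd.intro _ rfl)).1 this
    obtain ⟨u, v, huv⟩ := h.1 x y h1
    refine ⟨u, v, ?_⟩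
    rw [huv, ← mul_assoc, ← pow_two, ← mul_sub] at hxy
    push_cast at hxy ⊢
    rw [pow_add, mul_comm] at hxy
    exact (mul_dvd_mul_iff_left hp').1 hxy
  · rintro ⟨u, v, huv⟩
    obtain ⟨x, y, hxy⟩ := h.2 u v
    refine ⟨x, y, ?_⟩
    rw [hxy, ← mul_assoc, ← pow_two, ← mul_sub]
    push_cast at huv ⊢
    rw [pow_add, mul_comm]
    exact mul_dvd_mul_left _ huv

lemma repCount_succ_of_descentOne {d p k₀ k : ℕ} (h : DescentOne d p) (hp : p ≠ 0)
    (hk : k₀ ≤ k + 1) (hk0 : k₀ ≠ 0)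
    (H : ∀ a : ℤ, ¬ (p : ℤ) ∣ a → RepMod d (p ^ k₀) a → RepMod d (p ^ (k + 1)) a) :
    repCount d (p ^ (k + 1)) = p ^ (k + 1 - k₀) * unitCount d p k₀ + repCount d (p ^ k) := by
  classical
  have h1 := card_units_represented hk hk0 H
  have h2 := card_filter_range_mul p (p ^ k) (Nat.pos_of_ne_zero hp)
    (fun a : ℕ => RepMod d (p ^ (k + 1)) a)
  rw [← pow_succ'] at h2
  rw [← h1, repCount, repCount, h2]
  congr 2
  refine Finset.filter_congr fun b _ => ?_
  rw [Nat.cast_mul, h.repMod_iff hp]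

/-- Residues exactly divisible by `p` contribute nothing, and multiples of `p²` reproduce the count
for `d'` two levels down. -/
lemma repCount_succ_of_descentTwo {d d' p k₀ k : ℕ} (h : DescentTwo d d' p) (hp : p ≠ 0)
    (hk : k₀ ≤ k + 2) (hk0 : k₀ ≠ 0)
    (H : ∀ a : ℤ, ¬ (p : ℤ) ∣ a → RepMod d (p ^ k₀) a → RepMod d (p ^ (k + 2)) a) :
    repCount d (p ^ (k + 2)) = p ^ (k + 2 - k₀) * unitCount d p k₀ + repCount d' (p ^ k) := by
  classical
  have h1 := card_units_represented hk hk0 H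
  have hp0 := Nat.pos_of_ne_zero hp
  have e : p * (p * p ^ k) = p ^ (k + 2) := by ring
  have h3 := card_filter_range_mul p (p * p ^ k) hp0 (fun a : ℕ => RepMod d (p ^ (k + 2)) a)
  have h4 := card_filter_range_mul p (p ^ k) hp0
    (fun a : ℕ => RepMod d (p ^ (k + 2)) ((p * a : ℕ) : ℤ))
  have h2 : ((Finset.range (p * p ^ k)).filter
      fun a : ℕ => ¬ p ∣ a ∧ RepMod d (p ^ (k + 2)) ((p * a : ℕ) : ℤ)) = ∅ := by
    refine Finset.filter_eq_empty_iff.2 fun a _ ha => ha.1 ?_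
    have := ha.2
    rw [Nat.cast_mul] at this
    exact_mod_cast h.dvd_of_repMod hp this
  rw [h2, Finset.card_empty, zero_add] at h4
  rw [h4, e] at h3
  rw [← h1, repCount, repCount, h3]
  congr 2
  refine Finset.filter_congr fun b _ => ?_
  rw [Nat.cast_mul, Nat.cast_mul, h.repMod_iff hp]

/-- A two-step affine recursion with ratio `s² < 1` converges to its fixed point. -/
lemma tendsto_of_two_step {ρ : ℕ → ℝ} {υ s : ℝ} {K : ℕ} (hs : 0 < s) (hs1 : s < 1)
    (h : ∀ k, K ≤ k → ρ (k + 2) = υ + s ^ 2 * ρ k) :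
    Tendsto ρ atTop (𝓝 (υ / (1 - s ^ 2))) := by
  have hs2 : 1 - s ^ 2 ≠ 0 := by nlinarith
  set l := υ / (1 - s ^ 2) with hl
  have hfix : l = υ + s ^ 2 * l := by rw [hl]; field_simp; ring
  rw [← tendsto_add_atTop_iff_nat K]
  set B := max |ρ K - l| (|ρ (K + 1) - l| / s) with hB
  have hb : ∀ n, |ρ (n + K) - l| ≤ B * s ^ n ∧ |ρ (n + 1 + K) - l| ≤ B * s ^ (n + 1) := by
    intro n
    induction n with
    | zero =>
      refine ⟨by simp [hB], ?_⟩
      rw [zero_add, pow_one, ← div_le_iff₀ hs, add_comm 1 K]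
      exact le_max_right _ _
    | succ n ih =>
      refine ⟨ih.2, ?_⟩
      have e : ρ (n + 1 + 1 + K) - l = s ^ 2 * (ρ (n + K) - l) := by
        rw [show n + 1 + 1 + K = n + K + 2 by ring, h (n + K) (by omega)]
        linear_combination -hfix
      rw [e, abs_mul, abs_of_pos (by positivity)]
      calc _ ≤ s ^ 2 * (B * s ^ n) := mul_le_mul_of_nonneg_left ih.1 (by positivity)
        _ = _ := by ring
  rw [tendsto_iff_norm_sub_tendsto_zero]
  refine squeeze_zero (fun _ => norm_nonneg _) (fun n => (hb n).1) ?_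
  simpa using (tendsto_pow_atTop_nhds_zero_of_lt_one hs.le hs1).const_mul B

lemma tendsto_residueDensity_of_descentOne {d p k₀ : ℕ} (h : DescentOne d p) (hp : 1 < p)
    (hk0 : k₀ ≠ 0) (H : ∀ (k : ℕ) (a : ℤ), ¬ (p : ℤ) ∣ a → RepMod d (p ^ k₀) a →
      RepMod d (p ^ k) a) :
    Tendsto (residueDensity d p) atTop
      (𝓝 ((unitCount d p k₀ : ℝ) / (p : ℝ) ^ k₀ / (1 - (p : ℝ)⁻¹))) := by
  have hp1 : (1 : ℝ) < p := by exact_mod_cast hp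
  have hi : (p : ℝ)⁻¹ < 1 := inv_lt_one_of_one_lt₀ hp1
  have hi0 : 0 < (p : ℝ)⁻¹ := by positivity
  set υ := (unitCount d p k₀ : ℝ) / (p : ℝ) ^ k₀ with hυ
  have h1 : ∀ k, k₀ ≤ k + 1 →
      residueDensity d p (k + 1) = υ + (p : ℝ)⁻¹ * residueDensity d p k := by
    intro k hk
    rw [residueDensity_eq _ _ _ (by omega), residueDensity_eq _ _ _ (by omega),
      repCount_succ_of_descentOne h (by omega) hk hk0 (H (k + 1)), hυ]
    push_cast
    obtain ⟨j, hj⟩ := Nat.exists_eq_add_of_le hk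
    rw [hj, Nat.add_sub_cancel_left, add_div, pow_add, mul_div_mul_comm, mul_comm (_ / _) (_ / _)]
    congr 1
    · field_simp
    · rw [← pow_add, ← hj, pow_succ]; field_simp
  -- The one-step recursion is iterated twice to fit the two-step convergence lemma.
  have h2 := tendsto_of_two_step (ρ := residueDensity d p) (υ := υ + (p : ℝ)⁻¹ * υ)
    (s := (p : ℝ)⁻¹) (K := k₀) hi0 hi (fun k hk => by
      rw [h1 (k + 1) (by omega), h1 k (by omega)]; ring)
  have e : (υ + (p : ℝ)⁻¹ * υ) / (1 - (p : ℝ)⁻¹ ^ 2) = υ / (1 - (p : ℝ)⁻¹) := by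
    rw [div_eq_div_iff (by nlinarith) (by linarith)]; ring
  rwa [e] at h2

lemma residueDensity_add_two_of_descentTwo {d d' p k₀ : ℕ} (h : DescentTwo d d' p) (hp : 1 < p)
    (hk0 : k₀ ≠ 0) (H : ∀ (k : ℕ) (a : ℤ), ¬ (p : ℤ) ∣ a → RepMod d (p ^ k₀) a →
      RepMod d (p ^ k) a) (k : ℕ) (hk : k₀ ≤ k + 2) :
    residueDensity d p (k + 2) =
      (unitCount d p k₀ : ℝ) / (p : ℝ) ^ k₀ + (p : ℝ)⁻¹ ^ 2 * residueDensity d' p k := by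
  have hp1 : (1 : ℝ) < p := by exact_mod_cast hp
  rw [residueDensity_eq _ _ _ (by omega), residueDensity_eq _ _ _ (by omega),
    repCount_succ_of_descentTwo h (by omega) hk hk0 (H (k + 2))]
  push_cast
  obtain ⟨j, hj⟩ := Nat.exists_eq_add_of_le hk
  rw [hj, Nat.add_sub_cancel_left, add_div, pow_add]
  congr 1
  · field_simp
  · rw [← pow_add, ← hj, pow_add]; field_simp

lemma tendsto_residueDensity_of_descentTwo {d p k₀ : ℕ} (h : DescentTwo d d p) (hp : 1 < p)
    (hk0 : k₀ ≠ 0) (H : ∀ (k : ℕ) (a : ℤ), ¬ (p : ℤ) ∣ a → RepMod d (p ^ k₀) a →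
      RepMod d (p ^ k) a) :
    Tendsto (residueDensity d p) atTop
      (𝓝 ((unitCount d p k₀ : ℝ) / (p : ℝ) ^ k₀ / (1 - (p : ℝ)⁻¹ ^ 2))) := by
  have hp1 : (1 : ℝ) < p := by exact_mod_cast hp
  exact tendsto_of_two_step (K := k₀) (s := (p : ℝ)⁻¹) (by positivity) (inv_lt_one_of_one_lt₀ hp1) fun k hk =>
    residueDensity_add_two_of_descentTwo h hp hk0 H k (by omega)

end Residues

/-! ### Descent at inert primes and at primes dividing `2d` -/

section Descent

/-- As `-d` is a nonresidue, `p ∣ x² + d y²` forces `p` to divide both `x` and `y`. -/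
lemma descentTwo_of_isInert {d p : ℕ} (h : IsInert d p) : DescentTwo d d p := by
  have := Fact.mk h.1
  refine ⟨fun x y hxy => ?_, fun u v => ⟨p * u, p * v, by ring⟩⟩
  have h1 : legendreSym p (-(d : ℤ)) = -1 := by
    rw [jacobiSym.legendreSym.to_jacobiSym]; exact h.2.2
  obtain ⟨⟨u, rfl⟩, ⟨v, rfl⟩⟩ := legendreSym.prime_dvd_of_eq_neg_one h1
    (show (p : ℤ) ∣ x ^ 2 - -(d : ℤ) * y ^ 2 by rwa [neg_mul, sub_neg_eq_add])
  exact ⟨u, v, by ring⟩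

lemma descentTwo_three_two : DescentTwo 3 3 2 := by
  refine ⟨fun x y hxy => ?_, fun u v => ⟨2 * u, 2 * v, by push_cast; ring⟩⟩
  push_cast at hxy ⊢
  rcases Int.even_or_odd' x with ⟨a, rfl | rfl⟩ <;> rcases Int.even_or_odd' y with ⟨b, rfl | rfl⟩
  · exact ⟨a, b, by ring⟩
  · exfalso; ring_nf at hxy; omega
  · exfalso; ring_nf at hxy; omega
  -- For `x`, `y` odd, `x + y√-3` is divisible by `1 + √-3` or by `1 - √-3`, both of norm 4,
  -- according to `x - y` modulo 4. The witnesses are the coordinates of the quotient, up to sign.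
  · rcases Int.even_or_odd' (a - b) with ⟨t, ht | ht⟩
    · exact ⟨2 * b + 1 + t, t, by rw [show a = b + 2 * t by linarith]; ring⟩
    · refine ⟨2 * b + 1 - (b + t + 1), b + t + 1, ?_⟩
      rw [show a = b + 2 * t + 1 by linarith]; ring

lemma descentTwo_four_two : DescentTwo 4 1 2 := by
  refine ⟨fun x y hxy => ?_, fun u v => ⟨2 * u, v, by push_cast; ring⟩⟩
  push_cast at hxy ⊢
  rcases Int.even_or_odd' x with ⟨a, rfl | rfl⟩
  · exact ⟨a, y, by ring⟩
  · exfalso; ring_nf at hxy; omega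

lemma descentOne_self {p : ℕ} (hp : p.Prime) : DescentOne p p := by
  refine ⟨fun x y hxy => ?_, fun u v => ⟨p * v, u, by ring⟩⟩
  have h1 : (p : ℤ) ∣ x ^ 2 := (dvd_add_left (Dvd.intro _ rfl)).1 hxy
  obtain ⟨z, rfl⟩ := (Nat.prime_iff_prime_int.1 hp).dvd_of_dvd_pow h1
  exact ⟨y, z, by ring⟩

/-- Multiplication and division by a Gaussian integer of norm 2. -/
lemma descentOne_one_two : DescentOne 1 2 := by
  refine ⟨fun x y hxy => ?_, fun u v => ⟨u + v, u - v, by push_cast; ring⟩⟩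
  push_cast at hxy ⊢
  have h : (2 : ℤ) ∣ x - y := by
    rcases Int.even_or_odd' x with ⟨a, rfl | rfl⟩ <;>
      rcases Int.even_or_odd' y with ⟨b, rfl | rfl⟩ <;> ring_nf at hxy ⊢ <;> omega
  obtain ⟨t, ht⟩ := h
  exact ⟨y + t, t, by rw [show x = y + 2 * t by linarith]; ring⟩

end Descent

/-! ### Represented units at the base level -/

section Units

/-- Makes representability a bounded search, so that the small unit counts can be decided by
evaluation. -/
lemma repMod_natCast_iff {d m : ℕ} (hm : m ≠ 0) (a : ℕ) :
    RepMod d m a ↔ ∃ x ∈ Finset.range m, ∃ y ∈ Finset.range m,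
      (x ^ 2 + d * y ^ 2) % m = a % m := by
  have : NeZero m := ⟨hm⟩
  constructor
  · rintro ⟨x, y, h⟩
    refine ⟨(x : ZMod m).val, by simpa using ZMod.val_lt _, (y : ZMod m).val,
      by simpa using ZMod.val_lt _, ?_⟩
    change _ ≡ _ [MOD m]
    rw [← ZMod.natCast_eq_natCast_iff]
    rw [← ZMod.intCast_zmod_eq_zero_iff_dvd] at h
    push_cast at h ⊢
    simpa [sub_eq_zero] using h
  · rintro ⟨x, -, y, -, h⟩
    refine ⟨x, y, ?_⟩
    rw [← ZMod.intCast_zmod_eq_zero_iff_dvd]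
    have h' := (ZMod.natCast_eq_natCast_iff _ _ _).2 (show _ ≡ _ [MOD m] from h)
    push_cast at h' ⊢
    rw [h', sub_self]

lemma unitCount_eq {d p k₀ : ℕ} (hp : p ≠ 0) : unitCount d p k₀ =
    ((Finset.range (p ^ k₀)).filter fun a : ℕ => ¬ p ∣ a ∧ ∃ x ∈ Finset.range (p ^ k₀),
      ∃ y ∈ Finset.range (p ^ k₀), (x ^ 2 + d * y ^ 2) % (p ^ k₀) = a % (p ^ k₀)).card := by
  rw [unitCount]
  congr 1
  ext a
  simp only [Finset.mem_filter, repMod_natCast_iff (pow_ne_zero k₀ hp)]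

lemma unitCount_one_two : unitCount 1 2 3 = 2 := by rw [unitCount_eq two_ne_zero]; decide +kernel
lemma unitCount_two_two : unitCount 2 2 3 = 2 := by rw [unitCount_eq two_ne_zero]; decide +kernel
lemma unitCount_three_two : unitCount 3 2 3 = 4 := by rw [unitCount_eq two_ne_zero]; decide +kernel
lemma unitCount_four_two : unitCount 4 2 3 = 2 := by rw [unitCount_eq two_ne_zero]; decide +kernel
lemma unitCount_seven_two : unitCount 7 2 3 = 4 := by rw [unitCount_eq two_ne_zero]; decide +kernel
lemma unitCount_three_three : unitCount 3 3 1 = 1 := by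
  rw [unitCount_eq three_ne_zero]; decide +kernel
lemma unitCount_seven_seven : unitCount 7 7 1 = 3 := by
  rw [unitCount_eq (by norm_num)]; decide +kernel

open Polynomial in
lemma repMod_prime {d p : ℕ} (hp : p.Prime) (hp2 : p ≠ 2) (hd : ¬ p ∣ d) (a : ℤ) :
    RepMod d p a := by
  have := Fact.mk hp
  have hd' : (d : ZMod p) ≠ 0 := by rwa [Ne, ZMod.natCast_eq_zero_iff]
  obtain ⟨x, y, h⟩ := FiniteField.exists_root_sum_quadratic
    (f := (X ^ 2 - C (a : ZMod p) : (ZMod p)[X])) (g := (C (d : ZMod p) * X ^ 2 : (ZMod p)[X]))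
    (degree_X_pow_sub_C (by norm_num) _) (degree_C_mul_X_pow 2 hd')
    (by rw [ZMod.card]; exact Nat.odd_iff.1 (hp.odd_of_ne_two hp2))
  refine ⟨x.val, y.val, ?_⟩
  rw [← ZMod.intCast_zmod_eq_zero_iff_dvd]
  push_cast
  simp only [eval_sub, eval_pow, eval_X, eval_C, eval_mul] at h
  simp only [ZMod.natCast_val, ZMod.cast_id', id_eq]
  linear_combination h

lemma unitCount_prime {d p : ℕ} (hp : p.Prime) (hp2 : p ≠ 2) (hd : ¬ p ∣ d) :
    unitCount d p 1 = p - 1 := by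
  classical
  rw [unitCount, pow_one]
  have : (Finset.range p).filter (fun a : ℕ => ¬ p ∣ a ∧ RepMod d p a) = (Finset.range p).erase 0 := by
    ext a
    simp only [Finset.mem_filter, Finset.mem_range, Finset.mem_erase]
    constructor
    · rintro ⟨h1, h2, -⟩
      exact ⟨fun h => h2 (h ▸ dvd_zero p), h1⟩
    · rintro ⟨h1, h2⟩
      exact ⟨h2, fun h => by have := Nat.le_of_dvd (Nat.pos_of_ne_zero h1) h; omega,
        repMod_prime hp hp2 hd a⟩
  rw [Finset.filter_congr_decidable, this, Finset.card_erase_of_mem (by simpa using hp.pos), Finset.card_range]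

end Units

/-! ### Local densities prime by prime -/

section Densities

lemma tendsto_residueDensity_inert {d p : ℕ} (h : IsInert d p) :
    Tendsto (residueDensity d p) atTop (𝓝 ((1 + (p : ℝ)⁻¹)⁻¹)) := by
  have hp2 : p ≠ 2 := fun h2 => by have := h.2.1; rw [h2] at this; exact absurd this (by decide)
  have hd : ¬ p ∣ d := by
    intro hpd
    have := Fact.mk h.1
    have h1 : legendreSym p (-(d : ℤ)) = -1 := by
      rw [jacobiSym.legendreSym.to_jacobiSym]; exact h.2.2
    have h2 : legendreSym p (-(d : ℤ)) = 0 := by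
      rw [legendreSym.eq_zero_iff]
      push_cast
      rw [(ZMod.natCast_eq_zero_iff d p).2 hpd, neg_zero]
    omega
  have h1 := tendsto_residueDensity_of_descentTwo (descentTwo_of_isInert h) h.1.one_lt one_ne_zero
    fun k a ha hr => hr.lift_odd h.1 hp2 ha k
  rw [unitCount_prime h.1 hp2 hd, Nat.cast_sub h.1.one_le] at h1
  convert h1 using 2
  have hp1 : (1 : ℝ) < p := by exact_mod_cast h.1.one_lt
  have : (p : ℝ) ^ 2 - 1 ≠ 0 := by nlinarith
  have : (p : ℝ) + 1 ≠ 0 := by positivity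
  rw [div_div, eq_div_iff (by rw [pow_one]; field_simp; exact div_ne_zero ‹_› (by positivity))]
  push_cast
  field_simp
  ring

lemma residueDensity_eq_one {d p k : ℕ} (hp : p ≠ 0) (h : ∀ a : ℤ, RepMod d (p ^ k) a) :
    residueDensity d p k = 1 := by
  classical
  have hp' : (p : ℝ) ^ k ≠ 0 := by positivity
  rw [residueDensity_eq _ _ _ hp, repCount, Finset.filter_true_of_mem (p := fun a : ℕ => RepMod d (p ^ k) a) fun a _ => h a,
    Finset.card_range, Nat.cast_pow, div_self hp']

/-- Modulo `m` the form is `(x + s y)(x - s y)`. Solving `x + s y = a`, `x - s y = b` gives `x = (a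
+ b)/2` and `y = (a - b)/(2s)`; equal parity of `a`, `b` replaces inverting 2, so `m` may be even.
-/
lemma repMod_of_sq {d m : ℕ} {s a b : ℤ} (hs : (m : ℤ) ∣ s ^ 2 + d) (hsm : IsCoprime s m)
    (hab : (2 : ℤ) ∣ a - b) : RepMod d m (a * b) := by
  obtain ⟨c, e, hc⟩ := hsm
  obtain ⟨f, hf⟩ := hs
  obtain ⟨g, hg⟩ := hab
  refine ⟨b + g, c * g, f * (c * g) ^ 2 + g ^ 2 * e * (c * s + 1), ?_⟩
  have ha : a = b + 2 * g := by linarith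
  have hd : (d : ℤ) = m * f - s ^ 2 := by linarith
  rw [ha, hd]
  have hem : e * m = 1 - c * s := by linarith
  linear_combination (-(g ^ 2 * (c * s + 1))) * hem

lemma exists_sq_add_of_jacobiSym_eq_one {d p : ℕ} (hp : p.Prime)
    (h : jacobiSym (-(d : ℤ)) p = 1) : ∃ s : ℕ, (p : ℤ) ∣ (s : ℤ) ^ 2 + d ∧ ¬ p ∣ s := by
  have := Fact.mk hp
  rw [← jacobiSym.legendreSym.to_jacobiSym] at h
  have h0 : ((-(d : ℤ) : ℤ) : ZMod p) ≠ 0 := fun h' => by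
    rw [(legendreSym.eq_zero_iff p _).2 h'] at h; norm_num at h
  obtain ⟨s, hs⟩ := (legendreSym.eq_one_iff p h0).1 h
  refine ⟨s.val, ?_, ?_⟩
  · rw [← ZMod.intCast_zmod_eq_zero_iff_dvd]
    push_cast at hs ⊢
    simp only [ZMod.natCast_val, ZMod.cast_id', id_eq]
    linear_combination -hs
  · intro hd
    have : s = 0 := by
      rw [← ZMod.natCast_zmod_val s]; exact (ZMod.natCast_eq_zero_iff _ _).2 hd
    rw [this] at hs
    exact h0 (by simpa using hs)

lemma tendsto_residueDensity_split {d p : ℕ} (hp : p.Prime) (hp2 : p ≠ 2)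
    (h : jacobiSym (-(d : ℤ)) p = 1) : Tendsto (residueDensity d p) atTop (𝓝 1) := by
  refine tendsto_const_nhds.congr fun k => (residueDensity_eq_one hp.ne_zero fun a => ?_).symm
  obtain ⟨s, hs, hps⟩ := exists_sq_add_of_jacobiSym_eq_one hp h
  have hpp : Prime (p : ℤ) := Nat.prime_iff_prime_int.1 hp
  have hps' : ¬ (p : ℤ) ∣ s := by exact_mod_cast hps
  have hd : ¬ (p : ℤ) ∣ -(d : ℤ) := fun h' => by
    have := (dvd_add_left ((dvd_neg).1 h')).1 hs
    exact hps' (hpp.dvd_of_dvd_pow this)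
  obtain ⟨t, ht⟩ := exists_sq_mul_lift_odd hp hp2 (b := (s : ℤ) ^ 2) hd
    (by rw [← dvd_neg, show -(-(d : ℤ) - (s : ℤ) ^ 2) = (s : ℤ) ^ 2 + d by ring]; exact hs) k
  rcases Nat.eq_zero_or_pos k with rfl | hk
  · exact ⟨0, 0, by simp⟩
  have hcop : ¬ (p : ℤ) ∣ s * t := by
    intro h'
    have h1 : (p : ℤ) ∣ p ^ k := dvd_pow_self _ (by omega)
    have h2 := h1.trans ht
    rw [← mul_pow] at h2
    exact hd ((dvd_sub_left (h'.pow two_ne_zero)).1 h2)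
  have hc : IsCoprime ((s : ℤ) * t) ((p ^ k : ℕ) : ℤ) := by
    push_cast
    exact ((hpp.coprime_iff_not_dvd.2 hcop).symm).pow_right
  have h4 : ((p ^ k : ℕ) : ℤ) ∣ ((s : ℤ) * t) ^ 2 + d := by
    push_cast
    rw [show ((s : ℤ) * t) ^ 2 + d = -(-(d : ℤ) - (s : ℤ) ^ 2 * t ^ 2) by ring, dvd_neg]
    exact ht
  have hodd : Odd ((p ^ k : ℕ) : ℤ) := by
    exact_mod_cast (hp.odd_of_ne_two hp2).pow
  obtain ⟨j, hj⟩ := hodd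
  -- Factor as `a * 1`, which requires `a` odd; an even `a` is first shifted by the odd modulus `p ^
  -- k`.
  rcases Int.even_or_odd' a with ⟨i, rfl | rfl⟩
  · refine (repMod_of_sq (a := 2 * i + ((p ^ k : ℕ) : ℤ)) (b := 1) h4 hc
      ⟨i + j, by rw [hj]; ring⟩).congr ⟨1, by ring⟩
  · simpa using repMod_of_sq (a := 2 * i + 1) (b := 1) h4 hc ⟨i, by ring⟩

lemma tendsto_residueDensity_self {p : ℕ} (hp : p.Prime) (hp2 : p ≠ 2) :
    Tendsto (residueDensity p p) atTop
      (𝓝 ((unitCount p p 1 : ℝ) / (p : ℝ) ^ 1 / (1 - (p : ℝ)⁻¹))) :=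
  tendsto_residueDensity_of_descentOne (descentOne_self hp) hp.one_lt one_ne_zero
    fun k _ ha hr => hr.lift_odd hp hp2 ha k

lemma tendsto_residueDensity_three_three : Tendsto (residueDensity 3 3) atTop (𝓝 (1 / 2)) := by
  have h := tendsto_residueDensity_self Nat.prime_three (by norm_num)
  rw [unitCount_three_three] at h
  norm_num at h ⊢
  exact h

lemma tendsto_residueDensity_seven_seven : Tendsto (residueDensity 7 7) atTop (𝓝 (1 / 2)) := by
  have h := tendsto_residueDensity_self (show Nat.Prime 7 by norm_num) (by norm_num)
  rw [unitCount_seven_seven] at h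
  norm_num at h ⊢
  exact h

lemma tendsto_residueDensity_one_two : Tendsto (residueDensity 1 2) atTop (𝓝 (1 / 2)) := by
  have h := tendsto_residueDensity_of_descentOne descentOne_one_two one_lt_two three_ne_zero
    fun k _ ha hr => hr.lift_two ha k
  rw [unitCount_one_two] at h
  norm_num at h ⊢
  exact h

lemma tendsto_residueDensity_two_two : Tendsto (residueDensity 2 2) atTop (𝓝 (1 / 2)) := by
  have h := tendsto_residueDensity_of_descentOne (descentOne_self Nat.prime_two) one_lt_two
    three_ne_zero fun k _ ha hr => hr.lift_two ha k
  rw [unitCount_two_two] at h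
  norm_num at h ⊢
  exact h

lemma tendsto_residueDensity_three_two :
    Tendsto (residueDensity 3 2) atTop (𝓝 ((1 + ((2 : ℕ) : ℝ)⁻¹)⁻¹)) := by
  have h := tendsto_residueDensity_of_descentTwo descentTwo_three_two one_lt_two
    three_ne_zero fun k _ ha hr => hr.lift_two ha k
  rw [unitCount_three_two] at h
  norm_num at h ⊢
  exact h

/-- Descent passes from `x² + 4y²` to `x² + y²`, so the value is `2/8 + (1/4)(1/2)`. -/
lemma tendsto_residueDensity_four_two : Tendsto (residueDensity 4 2) atTop (𝓝 (3 / 8)) := by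
  have h := residueDensity_add_two_of_descentTwo descentTwo_four_two one_lt_two
    three_ne_zero fun k _ ha hr => hr.lift_two ha k
  rw [unitCount_four_two] at h
  rw [← tendsto_add_atTop_iff_nat 2]
  have h1 := (tendsto_residueDensity_one_two.const_mul ((((2 : ℕ) : ℝ)⁻¹) ^ 2)).const_add
    (((2 : ℕ) : ℝ) / ((2 : ℕ) : ℝ) ^ 3)
  rw [show (((2 : ℕ) : ℝ) / ((2 : ℕ) : ℝ) ^ 3) + (((2 : ℕ) : ℝ)⁻¹) ^ 2 * (1 / 2) = 3 / 8 by
    norm_num] at h1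
  refine h1.congr' ?_
  filter_upwards [eventually_ge_atTop 1] with k hk
  exact (h k (by omega)).symm

/-- `-7 ≡ 1` mod 8 is a 2-adic square, so the form splits; `4b = (2b) * 2` has two factors of equal
parity. -/
lemma repMod_seven_two (k : ℕ) (b : ℤ) : RepMod 7 (2 ^ k) (2 * (2 * b)) := by
  -- Level `k + 1` rather than `k`, so that `s` is forced to be odd even when `k = 0`.
  obtain ⟨s, hs⟩ := exists_sq_mul_lift_two (a := -7) (b := 1) (by decide) (by norm_num) (k + 1)
  have hso : Odd s := by
    by_contra h
    rw [Int.not_odd_iff_even] at h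
    obtain ⟨c, rfl⟩ := h
    have := (dvd_pow_self (2 : ℤ) (show k + 1 ≠ 0 by omega)).trans hs
    ring_nf at this
    omega
  have hc : IsCoprime s ((2 ^ k : ℕ) : ℤ) := by
    push_cast
    exact (Int.isCoprime_iff_gcd_eq_one.2 (by
      rw [Int.gcd_comm]
      exact Int.isCoprime_iff_gcd_eq_one.1
        ((Int.prime_two.coprime_iff_not_dvd).2 (by
          rw [← even_iff_two_dvd, Int.not_even_iff_odd]; exact hso)))).pow_right
  have h4 : ((2 ^ k : ℕ) : ℤ) ∣ s ^ 2 + (7 : ℕ) := by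
    push_cast
    rw [← dvd_neg]
    refine (pow_dvd_pow 2 (Nat.le_succ k)).trans ?_
    rw [show -(s ^ 2 + 7) = -7 - 1 * s ^ 2 by ring]
    exact hs
  have := repMod_of_sq (a := 2 * b) (b := 2) h4 hc ⟨b - 1, by ring⟩
  rwa [mul_comm (2 : ℤ) (2 * b)]

lemma not_repMod_seven_two {k : ℕ} {b : ℤ} (hk : 2 ≤ k) (hb : ¬ (2 : ℤ) ∣ b) :
    ¬ RepMod 7 (2 ^ k) (2 * b) := by
  rintro ⟨x, y, h⟩
  have h4 : (4 : ℤ) ∣ x ^ 2 + 7 * y ^ 2 - 2 * b := by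
    refine (show (4 : ℤ) ∣ ((2 ^ k : ℕ) : ℤ) from ?_).trans (by simpa using h)
    push_cast
    exact (by norm_num : (4 : ℤ) = 2 ^ 2) ▸ pow_dvd_pow 2 hk
  rcases Int.even_or_odd' x with ⟨a, rfl | rfl⟩ <;> rcases Int.even_or_odd' y with ⟨c, rfl | rfl⟩ <;>
    ring_nf at h4 <;> omega

/-- All odd classes and all multiples of 4 are values, and no class `2` mod 4 is: `1/2 + 1/4`. -/
lemma tendsto_residueDensity_seven_two : Tendsto (residueDensity 7 2) atTop (𝓝 (3 / 4)) := by
  classical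
  rw [← tendsto_add_atTop_iff_nat 3]
  refine tendsto_const_nhds.congr fun k => Eq.symm ?_
  have h1 := card_units_represented (d := 7) (p := 2) (k₀ := 3) (k := k + 3) (by omega)
    three_ne_zero fun a ha hr => hr.lift_two ha (k + 3)
  rw [unitCount_seven_two] at h1
  have e : 2 * (2 * 2 ^ (k + 1)) = 2 ^ (k + 3) := by ring
  have h3 := card_filter_range_mul 2 (2 * 2 ^ (k + 1)) two_pos
    (fun a : ℕ => RepMod 7 (2 ^ (k + 3)) a)
  have h4 := card_filter_range_mul 2 (2 ^ (k + 1)) two_pos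
    (fun a : ℕ => RepMod 7 (2 ^ (k + 3)) ((2 * a : ℕ) : ℤ))
  have h5 : ((Finset.range (2 * 2 ^ (k + 1))).filter
      fun a : ℕ => ¬ 2 ∣ a ∧ RepMod 7 (2 ^ (k + 3)) ((2 * a : ℕ) : ℤ)) = ∅ := by
    refine Finset.filter_eq_empty_iff.2 fun a _ ha => ?_
    refine not_repMod_seven_two (k := k + 3) (b := a) (by omega) (by exact_mod_cast ha.1) ?_
    have := ha.2
    rwa [Nat.cast_mul] at this
  have h6 : ((Finset.range (2 ^ (k + 1))).filter
      fun b : ℕ => RepMod 7 (2 ^ (k + 3)) ((2 * (2 * b) : ℕ) : ℤ)) = Finset.range (2 ^ (k + 1)) := by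
    refine Finset.filter_true_of_mem fun b _ => ?_
    rw [Nat.cast_mul, Nat.cast_mul]
    exact repMod_seven_two _ b
  rw [h5, h6, Finset.card_empty, zero_add, Finset.card_range] at h4
  rw [h4, e, h1] at h3
  rw [residueDensity_eq _ _ _ two_ne_zero, repCount, h3]
  rw [show k + 3 - 3 = k by omega]
  push_cast
  rw [pow_add, pow_add]
  field_simp
  norm_num

end Densities

/-! ### Membership in `Q_d` -/

section SetQ

/-- Infinite descent: a value divisible by `p` is `p²` times a smaller value of the same form. -/
lemma isQ_of_descentTwo {d p : ℕ} (hp : p.Prime) (h : DescentTwo d d p) : IsQ d p := by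
  have := Fact.mk hp
  refine ⟨hp, fun n => ?_⟩
  induction n using Nat.strong_induction_on with
  | _ n ih =>
    rintro hn ⟨x, y, hxy⟩
    by_cases hpn : p ∣ n
    · obtain ⟨u, v, huv⟩ := h.1 x y (hxy ▸ Int.natCast_dvd_natCast.2 hpn)
      have hm0 : 0 ≤ u ^ 2 + (d : ℤ) * v ^ 2 := by positivity
      obtain ⟨m, hm⟩ := Int.eq_ofNat_of_zero_le hm0
      have hnm : n = p ^ 2 * m := by
        have : (n : ℤ) = p ^ 2 * m := by rw [hxy, huv, hm]
        exact_mod_cast this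
      have hmpos : 0 < m := Nat.pos_of_ne_zero fun h0 => by rw [h0] at hnm; omega
      have hlt : m < n := by
        rw [hnm]
        have : 1 < p ^ 2 := Nat.one_lt_pow two_ne_zero hp.one_lt
        nlinarith
      have := ih m hlt hmpos ⟨u, v, hm.symm⟩
      rw [hnm, padicValNat.mul (pow_ne_zero 2 hp.ne_zero) hmpos.ne', padicValNat.prime_pow]
      exact even_two.add this
    · rw [padicValNat.eq_zero_of_not_dvd hpn]
      exact Even.zero

lemma not_isQ_of_pow {d p k : ℕ} (hk : Odd k) (h : Represents d (p ^ k)) : ¬ IsQ d p := by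
  rintro ⟨hp, hq⟩
  have := Fact.mk hp
  have := hq _ (pow_pos hp.pos k) h
  rw [padicValNat.prime_pow] at this
  exact (Nat.not_even_iff_odd.2 hk) this

/-- If `p ∣ s² + d`, then `p` divides exactly once one of `s² + d` and `(s + p)² + d`, since these
differ by `2sp` modulo `p²`. -/
lemma not_isQ_of_jacobiSym_eq_one {d p : ℕ} (hp : p.Prime) (hp2 : p ≠ 2)
    (h : jacobiSym (-(d : ℤ)) p = 1) : ¬ IsQ d p := by
  have := Fact.mk hp
  obtain ⟨s, hs, hps⟩ := exists_sq_add_of_jacobiSym_eq_one hp h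
  have key : ∀ s : ℕ, p ∣ s ^ 2 + d → ¬ p ^ 2 ∣ s ^ 2 + d → ¬ IsQ d p := by
    rintro s ⟨m, hm⟩ h2 ⟨-, hq⟩
    have hpm : ¬ p ∣ m := fun ⟨c, hc⟩ => h2 ⟨c, by rw [hm, hc]; ring⟩
    have hm0 : m ≠ 0 := fun h0 => hpm (h0 ▸ dvd_zero p)
    have := hq (s ^ 2 + d) (by rw [hm]; exact Nat.mul_pos hp.pos (Nat.pos_of_ne_zero hm0))
      ⟨s, 1, by push_cast; ring⟩
    rw [hm, padicValNat.mul hp.ne_zero hm0, padicValNat.self hp.one_lt,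
      padicValNat.eq_zero_of_not_dvd hpm] at this
    exact absurd this (by decide)
  have hs' : p ∣ s ^ 2 + d := by exact_mod_cast hs
  by_cases h2 : p ^ 2 ∣ s ^ 2 + d
  · refine key (s + p) ?_ ?_
    · rw [show (s + p) ^ 2 + d = (s ^ 2 + d) + p * (2 * s + p) by ring]
      exact dvd_add hs' (Dvd.intro _ rfl)
    · rw [show (s + p) ^ 2 + d = (s ^ 2 + d + p ^ 2) + p * (2 * s) by ring]
      intro h3
      rw [Nat.dvd_add_right (dvd_add h2 dvd_rfl), pow_two] at h3
      have h4 := Nat.dvd_of_mul_dvd_mul_left hp.pos h3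
      rcases (Nat.Prime.dvd_mul hp).1 h4 with h5 | h5
      · exact hp2 ((Nat.prime_dvd_prime_iff_eq hp Nat.prime_two).1 h5)
      · exact hps h5
  · exact key s hs' h2

end SetQ

/-! ### Assembling the product and the limit -/

section Assembly

lemma classify_prime {d p : ℕ} (hp : p.Prime) :
    IsInert d p ∨ (p ≠ 2 ∧ jacobiSym (-(d : ℤ)) p = 1) ∨ p ∣ 2 * d := by
  by_cases h : p ∣ 2 * d
  · exact Or.inr (Or.inr h)
  have hp2 : p ≠ 2 := fun h2 => h (h2 ▸ Dvd.intro _ rfl)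
  have hg : (-(d : ℤ)).gcd p = 1 := by
    rw [Int.neg_gcd, Int.gcd_natCast_natCast]
    exact Nat.coprime_comm.1 (hp.coprime_iff_not_dvd.2 fun h' => h (h'.mul_left 2))
  rcases jacobiSym.eq_one_or_neg_one hg with h1 | h1
  · exact Or.inr (Or.inl ⟨hp2, h1⟩)
  · exact Or.inl ⟨hp, hp.odd_of_ne_two hp2, h1⟩

/-- Local data at the primes dividing `2d`: the set `E` of non-inert primes in `Q_d`, and the local
densities `W` at the primes of `R_d`. -/
structure RamifiedData (d : ℕ) (E : Finset ℕ) (W : ℕ → ℝ) : Prop where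
  isQ_iff : ∀ p, p.Prime → p ∣ 2 * d → (IsQ d p ↔ p ∈ E)
  dvd_of_mem : ∀ p ∈ E, p.Prime ∧ p ∣ 2 * d
  tendsto_of_mem : ∀ p ∈ E, Tendsto (residueDensity d p) atTop (𝓝 ((1 + (p : ℝ)⁻¹)⁻¹))
  tendsto_of_not_mem : ∀ p, p.Prime → p ∣ 2 * d → p ∉ E →
    Tendsto (residueDensity d p) atTop (𝓝 (W p))
  prod_eq : (∏ p ∈ (2 * d).primeFactors \ E, W p) * ∏ p ∈ E, (1 + (p : ℝ)⁻¹)⁻¹ = deltaConst d / 2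

variable {d : ℕ} {E : Finset ℕ} {W : ℕ → ℝ}

lemma not_isInert_of_dvd {p : ℕ} (h : p ∣ 2 * d) : ¬ IsInert d p := by
  intro hi
  have := Fact.mk hi.1
  rcases hi.1.dvd_mul.1 h with h2 | h2
  · have := (Nat.prime_dvd_prime_iff_eq hi.1 Nat.prime_two).1 h2
    have hodd := hi.2.1
    rw [this] at hodd
    exact absurd hodd (by decide)
  · have h3 := hi.2.2
    rw [← jacobiSym.legendreSym.to_jacobiSym] at h3
    have h4 : legendreSym p (-(d : ℤ)) = 0 := by
      rw [legendreSym.eq_zero_iff]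
      push_cast
      rw [(ZMod.natCast_eq_zero_iff d p).2 h2, neg_zero]
    omega

lemma RamifiedData.isQ_iff_isInert_or (h : RamifiedData d E W) (p : ℕ) :
    IsQ d p ↔ IsInert d p ∨ p ∈ E := by
  constructor
  · intro hq
    rcases classify_prime (d := d) hq.1 with h1 | ⟨h2, h1⟩ | h1
    · exact Or.inl h1
    · exact absurd hq (not_isQ_of_jacobiSym_eq_one hq.1 h2 h1)
    · exact Or.inr ((h.isQ_iff p hq.1 h1).1 hq)
  · rintro (h1 | h1)
    · exact isQ_of_descentTwo h1.1 (descentTwo_of_isInert h1)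
    · obtain ⟨hp, hd⟩ := h.dvd_of_mem p h1
      exact (h.isQ_iff p hp hd).2 h1

lemma RamifiedData.tendsto_of_isQ (h : RamifiedData d E W) {p : ℕ} (hq : IsQ d p) :
    Tendsto (residueDensity d p) atTop (𝓝 ((1 + (p : ℝ)⁻¹)⁻¹)) := by
  rcases (h.isQ_iff_isInert_or p).1 hq with h1 | h1
  · exact tendsto_residueDensity_inert h1
  · exact h.tendsto_of_mem p h1

lemma RamifiedData.primesR_eq (h : RamifiedData d E W) :
    primesR d = (2 * d).primeFactors \ E := by
  ext p
  simp only [primesR, Finset.mem_filter, Finset.mem_sdiff]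
  refine and_congr_right fun hp => not_congr ?_
  exact h.isQ_iff p (Nat.prime_of_mem_primeFactors hp) (Nat.dvd_of_mem_primeFactors hp)

lemma RamifiedData.tendsto_of_mem_primesR (h : RamifiedData d E W) {p : ℕ} (hp : p ∈ primesR d) :
    Tendsto (residueDensity d p) atTop (𝓝 (W p)) := by
  rw [h.primesR_eq, Finset.mem_sdiff] at hp
  exact h.tendsto_of_not_mem p (Nat.prime_of_mem_primeFactors hp.1)
    (Nat.dvd_of_mem_primeFactors hp.1) hp.2

lemma tendsto_of_not_isQ [NeZero d] {p : ℕ} (hp : p.Prime) (hq : ¬ IsQ d p) (hr : p ∉ primesR d) :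
    Tendsto (residueDensity d p) atTop (𝓝 1) := by
  classical
  rcases classify_prime (d := d) hp with h1 | ⟨h2, h1⟩ | h1
  · exact absurd (isQ_of_descentTwo h1.1 (descentTwo_of_isInert h1)) hq
  · exact tendsto_residueDensity_split hp h2 h1
  · have hd := NeZero.ne d
    refine absurd (Finset.mem_filter.2 ⟨Nat.mem_primeFactors.2 ⟨hp, h1, ?_⟩, hq⟩) hr
    omega

lemma RamifiedData.tendsto_localDensity [NeZero d] (h : RamifiedData d E W) {p : ℕ}
    (hp : p.Prime) : Tendsto (residueDensity d p) atTop (𝓝 (localDensity d p)) := by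
  refine tendsto_nhds_limUnder ?_
  by_cases hq : IsQ d p
  · exact ⟨_, h.tendsto_of_isQ hq⟩
  by_cases hr : p ∈ primesR d
  · exact ⟨_, h.tendsto_of_mem_primesR hr⟩
  · exact ⟨_, tendsto_of_not_isQ hp hq hr⟩

lemma RamifiedData.productDensity_eq [NeZero d] (h : RamifiedData d E W) {n : ℕ}
    (hn : ∀ p ∈ primesR d, p ≤ n) :
    productDensity d n =
      (∏ p ∈ primesR d, localDensity d p) * ∏ p ∈ primesQ d n, (1 + (p : ℝ)⁻¹)⁻¹ := by
  classical
  have hR : ∀ p ∈ primesR d, p.Prime ∧ ¬ IsQ d p := fun p hp =>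
    ⟨Nat.prime_of_mem_primeFactors (Finset.mem_filter.1 hp).1, (Finset.mem_filter.1 hp).2⟩
  have h1 : ∏ p ∈ primesR d, localDensity d p = ∏ p ∈ (Finset.Icc 1 n).filter Nat.Prime,
      if p ∈ primesR d then localDensity d p else 1 := by
    rw [← Finset.prod_filter]
    refine Finset.prod_congr ?_ fun _ _ => rfl
    ext p
    simp only [Finset.mem_filter, Finset.mem_Icc]
    exact ⟨fun hp => ⟨⟨⟨(hR p hp).1.one_le, hn p hp⟩, (hR p hp).1⟩, hp⟩, fun hp => hp.2⟩
  have h2 : ∏ p ∈ primesQ d n, (1 + (p : ℝ)⁻¹)⁻¹ = ∏ p ∈ (Finset.Icc 1 n).filter Nat.Prime,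
      if IsQ d p then (1 + (p : ℝ)⁻¹)⁻¹ else 1 := by
    rw [← Finset.prod_filter]
    refine Finset.prod_congr ?_ fun _ _ => rfl
    ext p
    simp only [primesQ, Finset.mem_filter]
    exact ⟨fun hp => ⟨⟨hp.1, hp.2.1⟩, hp.2⟩, fun hp => ⟨hp.1.1, hp.2⟩⟩
  rw [h1, h2, ← Finset.prod_mul_distrib, productDensity]
  refine Finset.prod_congr rfl fun p hp => ?_
  have hp := (Finset.mem_filter.1 hp).2
  have ht := h.tendsto_localDensity hp
  by_cases hq : IsQ d p
  · rw [if_pos hq, if_neg (fun hr => (hR p hr).2 hq), one_mul]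
    exact tendsto_nhds_unique ht (h.tendsto_of_isQ hq)
  by_cases hr : p ∈ primesR d
  · rw [if_neg hq, if_pos hr, mul_one]
  · rw [if_neg hq, if_neg hr, mul_one]
    exact tendsto_nhds_unique ht (tendsto_of_not_isQ hp hq hr)

lemma RamifiedData.eventually_productDensity_eq [NeZero d] (h : RamifiedData d E W) :
    ∀ᶠ n : ℕ in atTop, productDensity d n =
      deltaConst d / 2 * ∏ q ∈ inertPrimes d n, (1 + (q : ℝ)⁻¹)⁻¹ := by
  classical
  have hd := NeZero.ne d
  filter_upwards [eventually_ge_atTop (2 * d)] with n hn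
  have hle : ∀ p, p ∣ 2 * d → p ≤ n := fun p hp => (Nat.le_of_dvd (by omega) hp).trans hn
  rw [h.productDensity_eq fun p hp =>
    hle p (Nat.dvd_of_mem_primeFactors (Finset.mem_filter.1 hp).1)]
  have hQ : primesQ d n = inertPrimes d n ∪ E := by
    ext p
    simp only [primesQ, inertPrimes, Finset.mem_filter, Finset.mem_union, h.isQ_iff_isInert_or,
      Finset.mem_Icc]
    constructor
    · rintro ⟨h1, h2 | h2⟩
      · exact Or.inl ⟨h1, h2⟩
      · exact Or.inr h2
    · rintro (⟨h1, h2⟩ | h2)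
      · exact ⟨h1, Or.inl h2⟩
      · obtain ⟨hp, hdvd⟩ := h.dvd_of_mem p h2
        exact ⟨⟨hp.one_le, hle p hdvd⟩, Or.inr h2⟩
  have hdisj : Disjoint (inertPrimes d n) E := by
    refine Finset.disjoint_left.2 fun p hp hE => ?_
    exact not_isInert_of_dvd (h.dvd_of_mem p hE).2 (Finset.mem_filter.1 hp).2
  have hW : ∏ p ∈ primesR d, localDensity d p = ∏ p ∈ (2 * d).primeFactors \ E, W p := by
    rw [← h.primesR_eq]
    refine Finset.prod_congr rfl fun p hp => ?_
    exact tendsto_nhds_unique (h.tendsto_localDensity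
      (Nat.prime_of_mem_primeFactors (Finset.mem_filter.1 hp).1)) (h.tendsto_of_mem_primesR hp)
  rw [hQ, Finset.prod_union hdisj, hW, ← h.prod_eq]
  ring

lemma deltaConst_pos (d : ℕ) : 0 < deltaConst d := by
  unfold deltaConst; split_ifs <;> norm_num

lemma landauConst_pos {m : ℕ} [NeZero d] (hm : oddJacobi d m = -1) : 0 < landauConst d := by
  have hd := NeZero.ne d
  have h1 : (0 : ℝ) < Nat.totient (2 * d) := by exact_mod_cast Nat.totient_pos.2 (by omega)
  have h2 : (0 : ℝ) < ((2 * d : ℕ) : ℝ) := by exact_mod_cast (by omega)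
  have h3 := oddL_pos hm
  have h4 := deltaConst_pos d
  rw [landauConst, gConst_eq_exp]
  have := Real.pi_pos
  positivity

/-- `δ_d`, `g_d`, `L_d(1)` and `2d/φ(2d)` occur identically in both densities; what is left is the
`1/2` of `prod_eq`, the `π` of Shanks' formula and the `e^{-γ}` of Mertens. -/
lemma RamifiedData.tendsto_ratio {m : ℕ} [NeZero d] (h : RamifiedData d E W)
    (hm : oddJacobi d m = -1) :
    Tendsto (fun n : ℕ => productDensity d n / landauDensity d n) atTop
      (𝓝 (1 / 2 * Real.sqrt (Real.pi / Real.exp Real.eulerMascheroniConstant))) := by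
  have hd := NeZero.ne d
  have hβ := landauConst_pos hm
  have h1 := ((tendsto_prod_inertPrimes hm).const_mul (deltaConst d / 2)).div_const (landauConst d)
  have e : deltaConst d / 2 * (gConst d * Real.sqrt (oddL d * ((2 * d : ℕ) : ℝ) /
      (Nat.totient (2 * d) : ℝ) * Real.exp (-Real.eulerMascheroniConstant))) / landauConst d
      = 1 / 2 * Real.sqrt (Real.pi / Real.exp Real.eulerMascheroniConstant) := by
    have h1 : (0 : ℝ) < Nat.totient (2 * d) := by exact_mod_cast Nat.totient_pos.2 (by omega)
    have h2 : (0 : ℝ) < ((2 * d : ℕ) : ℝ) := by exact_mod_cast (by omega)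
    have h3 := oddL_pos hm
    have h4 := Real.pi_pos
    have e1 : oddL d * ((2 * d : ℕ) : ℝ) / (Nat.totient (2 * d) : ℝ)
        * Real.exp (-Real.eulerMascheroniConstant)
        = (oddL d * ((2 * d : ℕ) : ℝ) / (Real.pi * (Nat.totient (2 * d) : ℝ)))
          * (Real.pi / Real.exp Real.eulerMascheroniConstant) := by
      rw [Real.exp_neg]; field_simp
    rw [div_eq_iff hβ.ne', e1, Real.sqrt_mul (by positivity), landauConst]
    ring
  rw [e] at h1
  refine h1.congr' ?_
  filter_upwards [h.eventually_productDensity_eq] with n hn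
  rw [hn, landauDensity, div_div_eq_mul_div]
  ring

end Assembly

/-! ### The five forms -/

section Cases

lemma primeFactors_two_mul_one : (2 * 1).primeFactors = {2} := by decide +kernel
lemma primeFactors_two_mul_two : (2 * 2).primeFactors = {2} := by decide +kernel
lemma primeFactors_two_mul_three : (2 * 3).primeFactors = {2, 3} := by decide +kernel
lemma primeFactors_two_mul_four : (2 * 4).primeFactors = {2} := by decide +kernel
lemma primeFactors_two_mul_seven : (2 * 7).primeFactors = {2, 7} := by decide +kernel

/-- A single prime `2` dividing `2d`, not in `Q_d`. -/
lemma ramifiedData_of_primeFactors_eq_two {d : ℕ} [NeZero d] {w : ℝ}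
    (hf : (2 * d).primeFactors = {2}) (hq : ¬ IsQ d 2)
    (ht : Tendsto (residueDensity d 2) atTop (𝓝 w)) (hw : w = deltaConst d / 2) :
    RamifiedData d ∅ fun _ => w := by
  have h2 : ∀ p, p.Prime → p ∣ 2 * d → p = 2 := fun p hp hd => by
    have : p ∈ (2 * d).primeFactors :=
      Nat.mem_primeFactors.2 ⟨hp, hd, mul_ne_zero two_ne_zero (NeZero.ne d)⟩
    simpa [hf] using this
  refine ⟨fun p hp hd => ?_, by simp, by simp, fun p hp hd _ => ?_, ?_⟩
  · rw [h2 p hp hd]; simpa using hq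
  · rw [h2 p hp hd]; exact ht
  · rw [hf]; simpa using hw

lemma ramifiedData_one : RamifiedData 1 ∅ fun _ => 1 / 2 :=
  ramifiedData_of_primeFactors_eq_two primeFactors_two_mul_one
    (not_isQ_of_pow odd_one ⟨1, 1, by norm_num⟩) tendsto_residueDensity_one_two
    (by norm_num [deltaConst])

lemma ramifiedData_two : RamifiedData 2 ∅ fun _ => 1 / 2 :=
  ramifiedData_of_primeFactors_eq_two primeFactors_two_mul_two
    (not_isQ_of_pow odd_one ⟨0, 1, by norm_num⟩) tendsto_residueDensity_two_two
    (by norm_num [deltaConst])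

/-- As 2 is not of the form `x² + 4y²`, the odd power used is `8 = 2² + 4 * 1²`. -/
lemma ramifiedData_four : RamifiedData 4 ∅ fun _ => 3 / 8 :=
  ramifiedData_of_primeFactors_eq_two primeFactors_two_mul_four
    (not_isQ_of_pow (k := 3) (by decide) ⟨2, 1, by norm_num⟩) tendsto_residueDensity_four_two
    (by norm_num [deltaConst])

lemma eq_or_eq_of_dvd_two_mul {p q : ℕ} (hp : p.Prime) (hq : q.Prime) (h : p ∣ 2 * q) :
    p = 2 ∨ p = q := by
  rcases hp.dvd_mul.1 h with h | h
  · exact Or.inl ((Nat.prime_dvd_prime_iff_eq hp Nat.prime_two).1 h)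
  · exact Or.inr ((Nat.prime_dvd_prime_iff_eq hp hq).1 h)

lemma ramifiedData_three : RamifiedData 3 {2} fun _ => 1 / 2 := by
  refine ⟨fun p hp hd => ?_, by simp [Nat.prime_two], ?_, fun p hp hd hE => ?_, ?_⟩
  · rcases eq_or_eq_of_dvd_two_mul hp Nat.prime_three hd with rfl | rfl
    · simpa using isQ_of_descentTwo Nat.prime_two descentTwo_three_two
    · simpa using not_isQ_of_pow (d := 3) (p := 3) odd_one ⟨0, 1, by norm_num⟩
  · intro p hp
    obtain rfl := Finset.mem_singleton.1 hp
    exact tendsto_residueDensity_three_two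
  · rcases eq_or_eq_of_dvd_two_mul hp Nat.prime_three hd with rfl | rfl
    · simp at hE
    · exact tendsto_residueDensity_three_three
  · rw [primeFactors_two_mul_three, show ({2, 3} : Finset ℕ) \ {2} = {3} by decide]
    norm_num [deltaConst]

lemma ramifiedData_seven : RamifiedData 7 ∅ fun p => if p = 2 then 3 / 4 else 1 / 2 := by
  have h7 : Nat.Prime 7 := by norm_num
  refine ⟨fun p hp hd => ?_, by simp, by simp, fun p hp hd hE => ?_, ?_⟩
  · rcases eq_or_eq_of_dvd_two_mul hp h7 hd with rfl | rfl
    · simpa using not_isQ_of_pow (d := 7) (p := 2) (k := 3) (by decide) ⟨1, 1, by norm_num⟩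
    · simpa using not_isQ_of_pow (d := 7) (p := 7) odd_one ⟨0, 1, by norm_num⟩
  · rcases eq_or_eq_of_dvd_two_mul hp h7 hd with rfl | rfl
    · simpa using tendsto_residueDensity_seven_two
    · simpa using tendsto_residueDensity_seven_seven
  · rw [primeFactors_two_mul_seven, Finset.sdiff_empty, Finset.prod_pair (by norm_num)]
    norm_num [deltaConst]

end Cases

/-- The witness `m`, 3 or 5, certifies that the character `(-d / ·)` is nontrivial. -/
lemma exists_ramifiedData {d : ℕ} (hd : d ∈ ({1, 2, 3, 4, 7} : Set ℕ)) :
    d ≠ 0 ∧ (∃ E W, RamifiedData d E W) ∧ ∃ m, oddJacobi d m = -1 := by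
  simp only [Set.mem_insert_iff, Set.mem_singleton_iff] at hd
  rcases hd with rfl | rfl | rfl | rfl | rfl
  · exact ⟨by norm_num, ⟨_, _, ramifiedData_one⟩, 3, by norm_num [oddJacobi, Nat.odd_iff]⟩
  · exact ⟨by norm_num, ⟨_, _, ramifiedData_two⟩, 5, by norm_num [oddJacobi, Nat.odd_iff]⟩
  · exact ⟨by norm_num, ⟨_, _, ramifiedData_three⟩, 5, by norm_num [oddJacobi, Nat.odd_iff]⟩
  · exact ⟨by norm_num, ⟨_, _, ramifiedData_four⟩, 3, by norm_num [oddJacobi, Nat.odd_iff]⟩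
  · exact ⟨by norm_num, ⟨_, _, ramifiedData_seven⟩, 3, by norm_num [oddJacobi, Nat.odd_iff]⟩

end LocalDensity

theorem mainTheorem3 (d : ℕ) (hd : d ∈ ({1, 2, 3, 4, 7} : Set ℕ)) :
    -- the local densities exist as limits
    (∀ p : ℕ, p.Prime →
      Tendsto (LocalDensity.residueDensity d p) atTop (𝓝 (LocalDensity.localDensity d p))) ∧
    -- the product of local densities in terms of `Q_d` and `R_d`
    (∀ n : ℕ, (∀ p ∈ LocalDensity.primesR d, p ≤ n) →
      LocalDensity.productDensity d n =
        (∏ p ∈ LocalDensity.primesR d, LocalDensity.localDensity d p) *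
          ∏ p ∈ LocalDensity.primesQ d n, (1 + (p : ℝ)⁻¹)⁻¹) ∧
    -- the infinite product and the series in `β_d` converge, and `β_d` is positive
    Multipliable (LocalDensity.gFactor d) ∧
    Tendsto (LocalDensity.oddLPartialSum d) atTop (𝓝 (LocalDensity.oddL d)) ∧
    0 < LocalDensity.landauConst d ∧
    -- the ratio converges to the universal constant
    Tendsto (fun n : ℕ => LocalDensity.productDensity d n / LocalDensity.landauDensity d n) atTop
      (𝓝 (1 / 2 * Real.sqrt (Real.pi / Real.exp Real.eulerMascheroniConstant))) := by
  obtain ⟨hd0, ⟨E, W, h⟩, m, hm⟩ := LocalDensity.exists_ramifiedData hd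
  have : NeZero d := ⟨hd0⟩
  exact ⟨fun p hp => h.tendsto_localDensity hp, fun n hn => h.productDensity_eq hn,
    (LocalDensity.hasProd_gFactor d).multipliable, LocalDensity.tendsto_oddLPartialSum hm,
    LocalDensity.landauConst_pos hm, h.tendsto_ratio hm⟩
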